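/- Let $m\ge 0$. A *weak composition* of length $m$ is an element of $\mathbb{N}^m$ ($0\in\mathbb N$). A *diagram* is a finite set of cells in the first quadrant, with rows $1,2,\dots$ numbered from bottom to top and columns $1,2,\dots$ from left to right; $\mathrm{wt}(T)_r$ is the number of cells of $T$ in row $r$. A *Kohnert move* takes the rightmost cell of a row and moves it down, within its column, to the first vacant position below it, if there is one (jumping over cells in its way). For $\alpha\in\mathbb N^n$, $\mathrm{KD}(\alpha)$ is the set of diagrams obtained by some (possibly empty) sequence of Kohnert moves from the diagram $\mathbb D(\alpha)$ with $\alpha_i$ left-justified cells in row $i$ for each $i$. A diagram is *rectified* if it lies in $\mathrm{KD}(\alpha)$ for some weak composition $\alpha$ of some length. *Threads.* The cells of a diagram are partitioned into threads: begin a new thread with the rightmost, then lowest, unthreaded cell; after threading a cell in column $c+1$, thread the lowest unthreaded cell in column $c$ weakly above it, and continue left until column $1$ or until no cell can be threaded; repeat until all cells are threaded. For $T$ rectified, $\theta(T)_r$ is the number of cells of the thread containing the cell in column $1$, row $r$ (and $0$ if there is no such cell). For $\alpha\in\mathbb N^m$, extended by zeros, $\mathrm{AKD}(\alpha)$ is the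 set of rectified diagrams $T$ with $\theta(T)=\alpha$. *Proper labelings.* For $\alpha\in\mathbb N^m$ and $T\in\mathrm{KD}(\alpha)$, the proper labeling $\mathcal L_\alpha(T)$ is defined column by column from right to left: once all columns to the right of column $c$ are labeled, the labels $\{i\mid\alpha_i\ge c\}$ are assigned bijectively to the cells of column $c$, from bottom to top, each cell receiving the smallest unused label $i$ such that the cell labeled $i$ in column $c+1$, if it exists, is weakly lower than the given cell. It is *pinned* if the label of each cell in column $1$ equals its row. Let $\mathrm{PKD}(\alpha)=\{T\in\mathrm{KD}(\alpha)\mid \mathcal L_\alpha(T)\text{ is pinned}\}$. The sets $\mathrm{KD}(\alpha)$, $\mathrm{AKD}(\alpha)$, $\mathrm{PKD}(\alpha)$ are finite, and for $\alpha\in\mathbb N^m$ the *Demazure character* $\kappa_\alpha$, the *Demazure atom* $\mathcal A_\alpha$ and the *pinned polynomial* $\mathcal P_\alpha$ are the sums of the monomials $x_1^{\mathrm{wt}(T)_1}\cdots x_m^{\mathrm{wt}(T)_m}$ over $T$ in $\mathrm{KD}(\alpha)$, $\mathrm{AKD}(\alpha)$ and $\mathrm{PKD}(\alpha)$ respectively.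 *Swaps.* A *left swap* on $\beta\in\mathbb N^m$ exchanges two parts $\beta_i<\beta_j$ with $i<j$; it is a *pinned left swap* if in addition $0<\beta_i$. Write $\alpha\preceq\beta$ (respectively $\alpha\preceq^0\beta$) if $\alpha$ is obtained from $\beta$ by a possibly empty sequence of left swaps (respectively pinned left swaps). **Proposition.** The family $\{\mathcal P_\beta\}_{\beta\in\mathbb N^m}$ is a $\mathbb Z$-basis of $\mathbb Z[x_1,\dots,x_m]$. Moreover, for all $\gamma,\beta\in\mathbb N^m$, $$\kappa_\gamma=\sum_{\substack{\beta\preceq\gamma\\ (\forall\alpha)\;\beta\preceq^0\alpha\preceq\gamma\Rightarrow\alpha=\beta}}\mathcal P_\beta \qquad\text{and}\qquad \mathcal P_\beta=\sum_{\alpha\preceq^0\beta}\mathcal A_\alpha .$$ -/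

import Mathlib

namespace Kohnert

/-! ## Diagrams and Kohnert moves

Rows and columns are numbered from `0`: the pair `(r, c)` is the cell in the `(r + 1)`-st row
(counted from the bottom) and the `(c + 1)`-st column (counted from the left) of the first
quadrant. -/

/-- A diagram: a finite set of cells `(row, column)` in the first quadrant. -/
abbrev Diagram : Type := Finset (ℕ × ℕ)

/-- The parts of a weak composition of length `m`, extended by zero to all indices. -/
def parts {m : ℕ} (α : Fin m → ℕ) (i : ℕ) : ℕ :=
  if h : i < m then α ⟨i, h⟩ else 0

/-- The composition diagram: `α i` left-justified cells in row `i`. -/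
def compDiagram {m : ℕ} (α : Fin m → ℕ) : Diagram :=
  (Finset.range m).biUnion fun i => (Finset.range (parts α i)).image fun c => (i, c)

/-- A Kohnert move from `T` to `T'`: the rightmost cell `(r, c)` of row `r` drops, within its
column, to the first vacant position `(r', c)` below it. -/
def KohnertMove (T T' : Diagram) : Prop :=
  ∃ r c r' : ℕ, (r, c) ∈ T ∧ (∀ d, c < d → (r, d) ∉ T) ∧
    r' < r ∧ (r', c) ∉ T ∧ (∀ s, r' < s → s < r → (s, c) ∈ T) ∧
    T' = insert (r', c) (T.erase (r, c))

/-- Kohnert diagrams of the weak composition `α`: everything reachable from the composition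
diagram by a (possibly empty) sequence of Kohnert moves. -/
def KD {m : ℕ} (α : Fin m → ℕ) : Set Diagram :=
  {T | Relation.ReflTransGen KohnertMove (compDiagram α) T}

/-- A diagram is rectified if it is a Kohnert diagram of some weak composition. -/
def IsRectified (T : Diagram) : Prop :=
  ∃ (n : ℕ) (α : Fin n → ℕ), T ∈ KD α

/-! ## Threads -/

/-- Rows, weakly above row `r`, of the cells of `U` in column `c`. -/
def rowsAbove (U : Diagram) (r c : ℕ) : Finset ℕ :=
  (U.filter fun x => x.2 = c ∧ r ≤ x.1).image Prod.fst

/-- The thread through the cell in column `c` and row `r`, continued to the left inside the set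
`U` of unthreaded cells: having threaded a cell in column `c + 1`, thread the lowest cell of `U` in
column `c` weakly above it, if there is one; stop otherwise, or at column `0`. -/
def threadFrom (U : Diagram) : ℕ → ℕ → Diagram
  | 0, r => {(r, 0)}
  | c + 1, r => insert (r, c + 1)
      (if h : (rowsAbove U r c).Nonempty then threadFrom U c ((rowsAbove U r c).min' h) else ∅)

/-- The rightmost nonempty column of `U`. -/
def lastCol (U : Diagram) : ℕ := U.sup Prod.snd

theorem mem_rowsAbove {U : Diagram} {r c s : ℕ} :
    s ∈ rowsAbove U r c ↔ (s, c) ∈ U ∧ r ≤ s := by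
  simp only [rowsAbove, Finset.mem_image, Finset.mem_filter, Prod.exists]
  constructor
  · rintro ⟨a, b, ⟨h1, h2, h3⟩, h4⟩
    subst h2 h4
    exact ⟨h1, h3⟩
  · rintro ⟨h1, h2⟩
    exact ⟨s, c, ⟨h1, rfl, h2⟩, rfl⟩

theorem lastCol_nonempty {U : Diagram} (h : U.Nonempty) :
    (rowsAbove U 0 (lastCol U)).Nonempty := by
  obtain ⟨x, hx, h2⟩ := Finset.exists_mem_eq_sup U h Prod.snd
  exact ⟨x.1, mem_rowsAbove.2 ⟨by rw [lastCol, h2]; exact hx, Nat.zero_le _⟩⟩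

/-- The first thread of `U`: it starts at the rightmost then lowest cell of `U`. -/
def firstThread (U : Diagram) (h : U.Nonempty) : Diagram :=
  threadFrom U (lastCol U) ((rowsAbove U 0 (lastCol U)).min' (lastCol_nonempty h))

theorem mem_threadFrom_self (U : Diagram) (c r : ℕ) : (r, c) ∈ threadFrom U c r := by
  cases c <;> simp [threadFrom]

theorem card_sdiff_firstThread_lt (U : Diagram) (h : U.Nonempty) :
    (U \ firstThread U h).card < U.card := by
  apply Finset.card_lt_card
  rw [Finset.ssubset_iff_of_subset Finset.sdiff_subset]
  refine ⟨((rowsAbove U 0 (lastCol U)).min' (lastCol_nonempty h), lastCol U), ?_, ?_⟩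
  · exact (mem_rowsAbove.1 (Finset.min'_mem _ (lastCol_nonempty h))).1
  · intro hx
    exact (Finset.mem_sdiff.1 hx).2 (mem_threadFrom_self _ _ _)

/-- The thread decomposition: extract the first thread, and continue with the unthreaded cells
until none is left. -/
def threads (U : Diagram) : List Diagram :=
  if h : U.Nonempty then firstThread U h :: threads (U \ firstThread U h) else []
termination_by U.card
decreasing_by exact card_sdiff_firstThread_lt U h

/-- The thread weight: the number of cells in the thread that contains the cell of row `r` in the
leftmost column (and `0` if there is no such cell). -/
def threadWeight (T : Diagram) (r : ℕ) : ℕ :=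
  (((threads T).filter fun t => (r, 0) ∈ t).map Finset.card).sum

/-- Atomic Kohnert diagrams of `α`: rectified diagrams with thread weight `α`. -/
def AKD {m : ℕ} (α : Fin m → ℕ) : Set Diagram :=
  {T | IsRectified T ∧ threadWeight T = parts α}

/-! ## Proper labelings and pinned Kohnert diagrams -/

/-- `L` is the proper labeling of `T` with respect to `α`: columns are labeled from right to left,
each column from bottom to top, and the cell `(r, c)` receives the smallest label `i` among those
with `c < α i` which are unused in the lower cells of column `c` and whose occurrence in column
`c + 1`, if it exists, is weakly lower than row `r`; all of the labels `i` with `c < α i` have to be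
used in column `c`. (Rows being numbered from `0`, so are the labels.) -/
def IsProperLabeling {m : ℕ} (α : Fin m → ℕ) (T : Diagram) (L : ℕ × ℕ → ℕ) : Prop :=
  (∀ r c, (r, c) ∈ T →
    IsLeast {i | c < parts α i ∧ (∀ s, s < r → (s, c) ∈ T → L (s, c) ≠ i) ∧
      (∀ s, (s, c + 1) ∈ T → L (s, c + 1) = i → s ≤ r)} (L (r, c))) ∧
  (∀ c i, c < parts α i → ∃ r, (r, c) ∈ T ∧ L (r, c) = i)

/-- The labeling described by `IsProperLabeling` is unique on the cells of `T`. -/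
theorem IsProperLabeling.unique {m : ℕ} {α : Fin m → ℕ} {T : Diagram} {L L' : ℕ × ℕ → ℕ}
    (hL : IsProperLabeling α T L) (hL' : IsProperLabeling α T L') :
    ∀ x ∈ T, L x = L' x := by
  have key : ∀ n c, lastCol T + 1 ≤ c + n → ∀ r, (r, c) ∈ T → L (r, c) = L' (r, c) := by
    intro n
    induction n with
    | zero =>
      intro c hc r hr
      have : c ≤ lastCol T := Finset.le_sup (f := Prod.snd) hr
      omega
    | succ n ih =>
      intro c hc r
      induction r using Nat.strong_induction_on with
      | _ r ihr =>
        intro hr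
        have h1 := hL.1 r c hr
        have h2 := hL'.1 r c hr
        have he : {i | c < parts α i ∧ (∀ s, s < r → (s, c) ∈ T → L (s, c) ≠ i) ∧
            (∀ s, (s, c + 1) ∈ T → L (s, c + 1) = i → s ≤ r)} =
            {i | c < parts α i ∧ (∀ s, s < r → (s, c) ∈ T → L' (s, c) ≠ i) ∧
            (∀ s, (s, c + 1) ∈ T → L' (s, c + 1) = i → s ≤ r)} := by
          ext i
          simp only [Set.mem_ofPred_eq]
          constructor
          · rintro ⟨a, b, d⟩
            refine ⟨a, fun s hs hsT => ?_, fun s hsT => ?_⟩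
            · rw [← ihr s hs hsT]; exact b s hs hsT
            · rw [← ih (c + 1) (by omega) s hsT]; exact d s hsT
          · rintro ⟨a, b, d⟩
            refine ⟨a, fun s hs hsT => ?_, fun s hsT => ?_⟩
            · rw [ihr s hs hsT]; exact b s hs hsT
            · rw [ih (c + 1) (by omega) s hsT]; exact d s hsT
        rw [he] at h1
        exact h1.unique h2
  rintro ⟨r, c⟩ hx
  exact key (lastCol T + 1) c (by omega) r hx

/-- A labeling is pinned if each entry in the leftmost column equals its row. -/
def IsPinned (T : Diagram) (L : ℕ × ℕ → ℕ) : Prop :=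
  ∀ r, (r, 0) ∈ T → L (r, 0) = r

/-- Pinned Kohnert diagrams of `α`: Kohnert diagrams whose proper labeling is pinned. -/
def PKD {m : ℕ} (α : Fin m → ℕ) : Set Diagram :=
  {T | T ∈ KD α ∧ ∃ L, IsProperLabeling α T L ∧ IsPinned T L}

/-! ## Finiteness of the sets of diagrams -/

theorem mem_compDiagram {m : ℕ} {α : Fin m → ℕ} {r c : ℕ} :
    (r, c) ∈ compDiagram α ↔ c < parts α r := by
  simp only [compDiagram, Finset.mem_biUnion, Finset.mem_range, Finset.mem_image, Prod.mk.injEq]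
  constructor
  · rintro ⟨i, _, d, h, rfl, rfl⟩
    exact h
  · intro h
    refine ⟨r, ?_, c, h, rfl, rfl⟩
    by_contra hr
    simp [parts, hr] at h

theorem parts_le_sum {m : ℕ} (α : Fin m → ℕ) (i : ℕ) : parts α i ≤ ∑ j, α j := by
  unfold parts
  split_ifs with h
  · exact Finset.single_le_sum (f := α) (fun _ _ => Nat.zero_le _) (Finset.mem_univ _)
  · exact Nat.zero_le _

theorem lt_of_parts_pos {m : ℕ} {α : Fin m → ℕ} {i : ℕ} (h : 0 < parts α i) : i < m := by
  by_contra hi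
  simp [parts, hi] at h

/-- The box that contains all the diagrams attached to `α`. -/
def box {m : ℕ} (α : Fin m → ℕ) : Diagram :=
  Finset.range m ×ˢ Finset.range (∑ j, α j)

theorem finite_of_subset_box {m : ℕ} (α : Fin m → ℕ) {S : Set Diagram}
    (h : ∀ T ∈ S, T ⊆ box α) : S.Finite :=
  (Finset.finite_toSet (box α).powerset).subset fun T hT => by simpa using h T hT

theorem finite_KD {m : ℕ} (α : Fin m → ℕ) : (KD α).Finite := by
  refine finite_of_subset_box α fun T hT => ?_
  have hT' : Relation.ReflTransGen KohnertMove (compDiagram α) T := hT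
  induction hT' with
  | refl =>
    rintro ⟨r, c⟩ hx
    have h := mem_compDiagram.1 hx
    simp only [box, Finset.mem_product, Finset.mem_range]
    exact ⟨lt_of_parts_pos ((Nat.zero_le c).trans_lt h), h.trans_le (parts_le_sum α r)⟩
  | tail h1 h2 ih =>
    obtain ⟨r, c, r', h, -, hr, -, -, rfl⟩ := h2
    have ih := ih h1
    have h3 := ih h
    intro x hx
    rcases Finset.mem_insert.1 hx with rfl | hx
    · simp only [box, Finset.mem_product, Finset.mem_range] at h3 ⊢
      omega
    · exact ih (Finset.mem_of_mem_erase hx)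

theorem finite_PKD {m : ℕ} (α : Fin m → ℕ) : (PKD α).Finite :=
  (finite_KD α).subset fun _ h => h.1

/-- In a rectified diagram, above each height, every column has at least as many cells as the next
column on its right. -/
theorem IsRectified.card_rowsAbove_le {T : Diagram} (hT : IsRectified T) :
    ∀ r c, (rowsAbove T r (c + 1)).card ≤ (rowsAbove T r c).card := by
  obtain ⟨n, α, hT⟩ := hT
  have hT' : Relation.ReflTransGen KohnertMove (compDiagram α) T := hT
  clear hT
  induction hT' with
  | refl =>
    intro r c
    apply Finset.card_le_card
    intro s hs
    rw [mem_rowsAbove, mem_compDiagram] at hs ⊢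
    omega
  | @tail U V h1 h2 ih =>
    clear h1
    obtain ⟨r, c, r', h, hright, hr, hvac, hfill, rfl⟩ := h2
    have other : ∀ s d, d ≠ c →
        rowsAbove (insert (r', c) (U.erase (r, c))) s d = rowsAbove U s d := by
      intro s d hd
      ext t
      simp [mem_rowsAbove, hd]
    have same : ∀ s t, t ∈ rowsAbove (insert (r', c) (U.erase (r, c))) s c ↔
        (t = r' ∨ (t ≠ r ∧ (t, c) ∈ U)) ∧ s ≤ t := by
      intro s t
      simp [mem_rowsAbove]
    have low : ∀ s, s ≤ r' →
        (rowsAbove (insert (r', c) (U.erase (r, c))) s c).card = (rowsAbove U s c).card := by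
      intro s hs
      have e : rowsAbove (insert (r', c) (U.erase (r, c))) s c
          = insert r' ((rowsAbove U s c).erase r) := by
        ext t
        rw [same, Finset.mem_insert, Finset.mem_erase, mem_rowsAbove]
        constructor
        · rintro ⟨h1 | h1, h2⟩
          · exact Or.inl h1
          · exact Or.inr ⟨h1.1, h1.2, h2⟩
        · rintro (h1 | h1)
          · exact ⟨Or.inl h1, by omega⟩
          · exact ⟨Or.inr ⟨h1.1, h1.2.1⟩, h1.2.2⟩
      rw [e, Finset.card_insert_of_notMem, Finset.card_erase_add_one]
      · exact mem_rowsAbove.2 ⟨h, by omega⟩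
      · intro h1
        exact hvac (mem_rowsAbove.1 (Finset.mem_of_mem_erase h1)).1
    intro s d
    by_cases hd : d = c
    · subst hd
      rw [other s (d + 1) (by omega)]
      rcases le_or_gt s r' with hs | hs
      · rw [low s hs]; exact ih s d
      · rcases le_or_gt s r with hs2 | hs2
        · have b1 : rowsAbove U s (d + 1) ⊆ Finset.Ico s r ∪ rowsAbove U (r + 1) (d + 1) := by
            intro t ht
            rw [mem_rowsAbove] at ht
            rw [Finset.mem_union, Finset.mem_Ico, mem_rowsAbove]
            have : t ≠ r := by
              rintro rfl
              exact hright (d + 1) (by omega) ht.1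
            rcases lt_or_gt_of_ne this with h1 | h1
            · exact Or.inl ⟨ht.2, h1⟩
            · exact Or.inr ⟨ht.1, h1⟩
          have b2 : Finset.Ico s r ∪ rowsAbove U (r + 1) d ⊆
              rowsAbove (insert (r', d) (U.erase (r, d))) s d := by
            intro t ht
            rw [Finset.mem_union, Finset.mem_Ico, mem_rowsAbove] at ht
            rw [same]
            rcases ht with ht | ht
            · exact ⟨Or.inr ⟨by omega, hfill t (by omega) ht.2⟩, ht.1⟩
            · exact ⟨Or.inr ⟨by omega, ht.1⟩, by omega⟩
          have b3 : Disjoint (Finset.Ico s r) (rowsAbove U (r + 1) d) := by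
            rw [Finset.disjoint_left]
            intro t ht1 ht2
            rw [Finset.mem_Ico] at ht1
            rw [mem_rowsAbove] at ht2
            omega
          have c1 := (Finset.card_le_card b1).trans (Finset.card_union_le _ _)
          have c2 := Finset.card_le_card b2
          rw [Finset.card_union_of_disjoint b3] at c2
          have := ih (r + 1) d
          omega
        · refine (ih s d).trans (Finset.card_le_card ?_)
          intro t ht
          rw [mem_rowsAbove] at ht
          rw [same]
          exact ⟨Or.inr ⟨by omega, ht.1⟩, ht.2⟩
    · rw [other s d hd]
      by_cases hd2 : d + 1 = c
      · subst hd2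
        refine le_trans ?_ (ih s d)
        rcases le_or_gt s r' with hs | hs
        · rw [low s hs]
        · apply Finset.card_le_card
          intro t ht
          rw [same] at ht
          rw [mem_rowsAbove]
          rcases ht with ⟨h1 | h1, h2⟩
          · omega
          · exact ⟨h1.2, h2⟩
      · rw [other s _ hd2]; exact ih s d

theorem snd_le_of_mem_threadFrom {U : Diagram} :
    ∀ {c r : ℕ} {x : ℕ × ℕ}, x ∈ threadFrom U c r → x.2 ≤ c := by
  intro c
  induction c with
  | zero =>
    intro r x hx
    simp only [threadFrom, Finset.mem_singleton] at hx
    simp [hx]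
  | succ c ih =>
    intro r x hx
    simp only [threadFrom, Finset.mem_insert] at hx
    rcases hx with rfl | hx
    · simp
    · split_ifs at hx with h
      · exact (ih hx).trans (Nat.le_succ c)
      · simp at hx

/-- With all cells unthreaded, threads of a rectified diagram reach the leftmost column. -/
theorem IsRectified.threadFrom_spec {T : Diagram} (hT : IsRectified T) :
    ∀ c r, (r, c) ∈ T →
      (∃ s, r ≤ s ∧ (s, 0) ∈ T ∧ (s, 0) ∈ threadFrom T c r) ∧
      c + 1 ≤ (threadFrom T c r).card := by
  intro c
  induction c with
  | zero =>
    intro r hr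
    exact ⟨⟨r, le_rfl, hr, by simp [threadFrom]⟩, by simp [threadFrom]⟩
  | succ c ih =>
    intro r hr
    have h1 : 0 < (rowsAbove T r (c + 1)).card :=
      Finset.card_pos.2 ⟨r, mem_rowsAbove.2 ⟨hr, le_rfl⟩⟩
    have h : (rowsAbove T r c).Nonempty :=
      Finset.card_pos.1 (h1.trans_le (hT.card_rowsAbove_le r c))
    have hm := mem_rowsAbove.1 (Finset.min'_mem _ h)
    obtain ⟨⟨s, hs1, hs2, hs3⟩, h3⟩ := ih _ hm.1
    have e : threadFrom T (c + 1) r =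
        insert (r, c + 1) (threadFrom T c ((rowsAbove T r c).min' h)) := by
      simp [threadFrom, h]
    rw [e]
    refine ⟨⟨s, hm.2.trans hs1, hs2, Finset.mem_insert_of_mem hs3⟩, ?_⟩
    rw [Finset.card_insert_of_notMem]
    · omega
    · intro hx
      have := snd_le_of_mem_threadFrom hx
      simp at this

theorem exists_mem_threads (U : Diagram) : ∀ x ∈ U, ∃ t ∈ threads U, x ∈ t := by
  induction hn : U.card using Nat.strong_induction_on generalizing U with
  | _ n ih =>
    intro x hx
    have hU : U.Nonempty := ⟨x, hx⟩
    rw [threads, dif_pos hU]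
    by_cases h : x ∈ firstThread U hU
    · exact ⟨_, List.mem_cons_self, h⟩
    · obtain ⟨t, ht, hxt⟩ := ih _ (hn ▸ card_sdiff_firstThread_lt U hU) _ rfl x
        (Finset.mem_sdiff.2 ⟨hx, h⟩)
      exact ⟨t, List.mem_cons_of_mem _ ht, hxt⟩

theorem card_le_threadWeight {T t : Diagram} {r : ℕ} (ht : t ∈ threads T) (hr : (r, 0) ∈ t) :
    t.card ≤ threadWeight T r := by
  apply List.le_sum_of_mem
  exact List.mem_map_of_mem (List.mem_filter.2 ⟨ht, by simpa using hr⟩)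

theorem finite_AKD {m : ℕ} (α : Fin m → ℕ) : (AKD α).Finite := by
  refine finite_of_subset_box α ?_
  rintro T ⟨hT, hw⟩ ⟨r, c⟩ hx
  simp only [box, Finset.mem_product, Finset.mem_range]
  constructor
  · obtain ⟨⟨s, hs1, hs2, -⟩, -⟩ := hT.threadFrom_spec c r hx
    obtain ⟨t, ht, hst⟩ := exists_mem_threads T _ hs2
    have h1 := card_le_threadWeight ht hst
    have h2 : 0 < t.card := Finset.card_pos.2 ⟨_, hst⟩
    rw [hw] at h1
    exact hs1.trans_lt (lt_of_parts_pos (h2.trans_le h1))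
  · have hne : T.Nonempty := ⟨_, hx⟩
    have hm := (mem_rowsAbove.1 (Finset.min'_mem _ (lastCol_nonempty hne))).1
    obtain ⟨⟨s, -, -, hs3⟩, h3⟩ := hT.threadFrom_spec _ _ hm
    have hmem : firstThread T hne ∈ threads T := by
      rw [threads, dif_pos hne]
      exact List.mem_cons_self
    have h1 : (firstThread T hne).card ≤ _ := card_le_threadWeight hmem hs3
    rw [hw] at h1
    have h2 : c ≤ lastCol T := Finset.le_sup (f := Prod.snd) hx
    have h4 : lastCol T + 1 ≤ (firstThread T hne).card := h3
    have := parts_le_sum α s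
    omega

/-! ## Generating polynomials -/

/-- The number of cells of `T` in row `r`. -/
def wt (T : Diagram) (r : ℕ) : ℕ := (T.filter fun x => x.1 = r).card

/-- The generating polynomial of a finite set of diagrams, with respect to row weights. -/
noncomputable def genPoly (m : ℕ) (S : Set Diagram) (hS : S.Finite) : MvPolynomial (Fin m) ℤ :=
  ∑ T ∈ hS.toFinset, ∏ r : Fin m, MvPolynomial.X r ^ wt T r

/-- The Demazure character (key polynomial) `κ_α`. -/
noncomputable def demazureCharacter {m : ℕ} (α : Fin m → ℕ) : MvPolynomial (Fin m) ℤ :=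
  genPoly m (KD α) (finite_KD α)

/-- The Demazure atom `𝒜_α`. -/
noncomputable def demazureAtom {m : ℕ} (α : Fin m → ℕ) : MvPolynomial (Fin m) ℤ :=
  genPoly m (AKD α) (finite_AKD α)

/-- The pinned polynomial `𝒫_α`. -/
noncomputable def pinnedPolynomial {m : ℕ} (α : Fin m → ℕ) : MvPolynomial (Fin m) ℤ :=
  genPoly m (PKD α) (finite_PKD α)

/-! ## Left swaps -/

/-- `α` results from `β` by a left swap: exchanging two parts `β i < β j` with `i < j`. -/
def LeftSwap {m : ℕ} (β α : Fin m → ℕ) : Prop :=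
  ∃ i j : Fin m, i < j ∧ β i < β j ∧ α = β ∘ Equiv.swap i j

/-- `α` results from `β` by a pinned left swap: exchanging two nonzero parts `0 < β i < β j` with
`i < j`. -/
def PinnedLeftSwap {m : ℕ} (β α : Fin m → ℕ) : Prop :=
  ∃ i j : Fin m, i < j ∧ 0 < β i ∧ β i < β j ∧ α = β ∘ Equiv.swap i j

/-- `α ⪯ β`: `α` is obtained from `β` by a (possibly empty) sequence of left swaps. -/
def SwapLE {m : ℕ} (α β : Fin m → ℕ) : Prop := Relation.ReflTransGen LeftSwap β α

/-- `α ⪯⁰ β`: `α` is obtained from `β` by a (possibly empty) sequence of pinned left swaps. -/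
def PinnedSwapLE {m : ℕ} (α β : Fin m → ℕ) : Prop := Relation.ReflTransGen PinnedLeftSwap β α

theorem PinnedSwapLE.swapLE {m : ℕ} {α β : Fin m → ℕ} (h : PinnedSwapLE α β) : SwapLE α β := by
  have h' : Relation.ReflTransGen PinnedLeftSwap β α := h
  induction h' with
  | refl => exact Relation.ReflTransGen.refl
  | tail h1 h2 ih =>
    obtain ⟨i, j, h3, -, h4, h5⟩ := h2
    exact Relation.ReflTransGen.tail (ih h1) ⟨i, j, h3, h4, h5⟩

theorem finite_swapLE {m : ℕ} (γ : Fin m → ℕ) : {β | SwapLE β γ}.Finite := by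
  refine (Set.finite_range fun σ : Equiv.Perm (Fin m) => γ ∘ σ).subset fun β hβ => ?_
  have hβ' : Relation.ReflTransGen LeftSwap γ β := hβ
  induction hβ' with
  | refl => exact ⟨1, rfl⟩
  | tail h1 h2 ih =>
    obtain ⟨σ, rfl⟩ := ih h1
    obtain ⟨i, j, -, -, rfl⟩ := h2
    exact ⟨σ * Equiv.swap i j, rfl⟩

theorem finite_pinnedSwapLE {m : ℕ} (β : Fin m → ℕ) : {α | PinnedSwapLE α β}.Finite :=
  (finite_swapLE β).subset fun _ h => PinnedSwapLE.swapLE h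

theorem finite_maximal {m : ℕ} (γ : Fin m → ℕ) :
    {β | SwapLE β γ ∧ ∀ α, PinnedSwapLE β α → SwapLE α γ → α = β}.Finite :=
  (finite_swapLE γ).subset fun _ h => h.1

/-- The finite set of all `α` with `α ⪯⁰ β`. -/
noncomputable def pinnedBelow {m : ℕ} (β : Fin m → ℕ) : Finset (Fin m → ℕ) :=
  (finite_pinnedSwapLE β).toFinset

/-- The finite set of all `β ⪯ γ` that are maximal for `⪯⁰` among those: if `β ⪯⁰ α ⪯ γ` then
`α = β`. -/
noncomputable def pinnedMaximalBelow {m : ℕ} (γ : Fin m → ℕ) : Finset (Fin m → ℕ) :=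
  (finite_maximal γ).toFinset

end Kohnert

/-!
Both expansions come from two equivalences: for a rectified diagram `T` with thread
weight `θ(T)`,

* `T ∈ KD γ` if and only if `θ(T) ⪯ γ` (`mem_KD_iff_of_mem_AKD`), and
* `T ∈ PKD β` if and only if `θ(T) ⪯⁰ β` (`mem_PKD_iff_of_mem_AKD`).

So `PKD β` is the disjoint union of the sets `AKD α` with `α ⪯⁰ β`, and `KD γ` is the disjoint union of
the sets `PKD β` with `β` pinned-maximal below `γ`, provided that each `α ⪯ γ` lies `⪯⁰`-below exactly
one such `β`.

*Key counts.* The cells of column `c` on threads that begin in column `d > c` or further right are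
found by parking those of column `c + 1` in column `c`: each cell takes the lowest free cell of
column `c` weakly above it, and the set of cells taken does not depend on the order of processing. Sets
of rows enter only through the functions counting their elements `≥ s`; pointwise comparison of these
is the entrywise comparison of sets, and parking becomes the recursion `park`. The resulting count
`keyCount T d 0 s` is the number of `r ≥ s` with `θ(T)_r > d` (`Rect.keyCount_succ_threadWeight`).

*Swaps.* Comparing, for all thresholds, the positions of the large parts is equivalent to `⪯`, and,
for compositions of equal support, to `⪯⁰` (`swapLE_iff`, `pinnedSwapLE_iff`).

*Kohnert diagrams.* Kohnert moves lower the key counts (`KohnertMove.keyCount_le`), so `θ(T) ⪯ γ` for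
`T ∈ KD γ`. Conversely left swaps on compositions are realized by Kohnert moves, and a rectified
diagram that is not left justified can be raised by an inverse Kohnert move without changing its key
counts (`Rect.exists_kohnertMove`), whence it is reached from the composition diagram of `θ(T)`.

*Pinned diagrams.* For `T ∈ KD β` a proper labeling exists by Hall's condition. The cells with label
`< t` are again governed by parking, and the key counts of `T` being bounded by those of `β`, no label
in the leftmost column is smaller than its row (`IsProperLabeling.le_label`). Hence the labeling is
pinned exactly when the leftmost column is the support of `β`.

*Unique maximal elements.* Among the compositions below `γ` with the support of `α ⪯ γ` there is a
greatest one: for each threshold, park the positions of the large parts of `γ` downwards in that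
support (`KeyLE.exists_greatest`).

*Basis.* Kohnert moves lower the sum of the rows of all cells, so `𝒫_β` is the monomial `x^β` plus
monomials `x^δ` with `∑ r, r * δ_r` smaller than `∑ r, r * β_r`.
-/

namespace Kohnert

/-! ### Parking -/

/-- Cars, of which `N s` prefer a spot in position `s` or above, park one after the other: each one
takes the lowest free spot weakly above its preferred position. With `b s ∈ {0, 1}` the number of
spots in position `s`, `park b N s` is the number of cars that park in position `s` or above, when
all of them can park; it does not depend on the order of the cars. A car passes from position `s`
to `s + 1` if it has not found a spot weakly below `s`; this gives the recursion, and truncated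
subtraction does no harm since `N (s + 1) ≥ 0`. -/
def park (b N : ℕ → ℕ) : ℕ → ℕ
  | 0 => N 0
  | s + 1 => max (N (s + 1)) (park b N s - b s)

theorem park_succ (b N : ℕ → ℕ) (s : ℕ) :
    park b N (s + 1) = max (N (s + 1)) (park b N s - b s) := rfl

theorem le_park (b N : ℕ → ℕ) (s : ℕ) : N s ≤ park b N s := by
  cases s with
  | zero => exact le_rfl
  | succ s => exact le_max_left _ _

theorem park_le_succ_add (b N : ℕ → ℕ) (s : ℕ) : park b N s ≤ park b N (s + 1) + b s := by
  rw [park_succ]; omega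

theorem park_mono (b : ℕ → ℕ) {N N' : ℕ → ℕ} (h : ∀ s, N s ≤ N' s) (s : ℕ) :
    park b N s ≤ park b N' s := by
  induction s with
  | zero => exact h 0
  | succ s ih =>
    have := h (s + 1)
    simp only [park_succ]; omega

theorem park_le {b N M : ℕ → ℕ} (h : ∀ s, N s ≤ M s) (hM : ∀ s, M s = M (s + 1) + b s) (s : ℕ) :
    park b N s ≤ M s := by
  induction s with
  | zero => exact h 0
  | succ s ih =>
    have := h (s + 1)
    have := hM s
    simp only [park_succ]; omega

theorem park_antitone {b N : ℕ → ℕ} (hN : ∀ s, N (s + 1) ≤ N s) (s : ℕ) :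
    park b N (s + 1) ≤ park b N s := by
  have := hN s
  have := le_park b N s
  rw [park_succ]; omega

theorem park_eq_self {b N : ℕ → ℕ} (hN : ∀ s, N s ≤ N (s + 1) + b s) (s : ℕ) :
    park b N s = N s := by
  induction s with
  | zero => rfl
  | succ s ih =>
    have := hN s
    rw [park_succ]; omega

/-- Moving a spot from position `r` down to the first vacant position `r'` below it moves the
parked cars down, if no car prefers `r`. In between, the two counts differ by one until the queue
of waiting cars is empty. -/
theorem park_lower_slot {b b' N : ℕ → ℕ} {r r' : ℕ} (hr : r' < r)
    (hN : ∀ s, N (s + 1) ≤ N s) (hN1 : ∀ s, N s ≤ N (s + 1) + 1) (hNr : N (r + 1) = N r)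
    (hbr : b r = 1) (hbr' : b r' = 0) (hfill : ∀ s, r' < s → s < r → b s = 1)
    (hb'r : b' r = 0) (hb'r' : b' r' = 1) (hb' : ∀ s, s ≠ r → s ≠ r' → b' s = b s) (s : ℕ) :
    park b' N s ≤ park b N s := by
  have key : park b' N s ≤ park b N s ∧ (s ≤ r' → park b' N s = park b N s) ∧
      (r' < s → s ≤ r → park b' N s + 1 = park b N s ∨ park b N s = N s) := by
    induction s with
    | zero => exact ⟨le_rfl, fun _ => rfl, fun h => absurd h (by omega)⟩
    | succ s ih =>
      obtain ⟨h1, h2, h3⟩ := ih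
      have h4 := hN s
      have h5 := hN1 s
      have h6 := le_park b N s
      have h7 := le_park b' N s
      simp only [park_succ]
      rcases lt_trichotomy s r' with h | h | h
      · rw [hb' s (by omega) (by omega)]
        have := h2 (by omega)
        refine ⟨by omega, fun _ => by omega, fun _ => by omega⟩
      · subst h
        have := h2 le_rfl
        rw [hbr', hb'r']
        refine ⟨by omega, fun _ => by omega, fun _ _ => by omega⟩
      · rcases lt_trichotomy s r with h' | h' | h'
        · rw [hb' s (by omega) (by omega), hfill s h h']
          have := h3 h (by omega)
          refine ⟨by omega, fun _ => by omega, fun _ _ => by omega⟩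
        · subst h'
          have := h3 h le_rfl
          rw [hb'r, hbr]
          refine ⟨by omega, fun _ => by omega, fun _ _ => by omega⟩
        · rw [hb' s (by omega) (by omega)]
          refine ⟨by omega, fun _ => by omega, fun _ _ => by omega⟩
  exact key.1

/-- Cars that all find a spot at their preferred position `s` (at most one for each `s`): if the
spot `y` is moved up to the first vacant position `v` above it, then the car in `y`, if any, parks in
the first position above `y` that has no car, and all positions that it passes carry a car. -/
theorem park_raise_slot {b b' N : ℕ → ℕ} {y v : ℕ} (hyv : y < v)
    (hN : ∀ s, N s = N (s + 1) ∨ N s = N (s + 1) + 1) (hNb : ∀ s, N s ≤ N (s + 1) + b s)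
    (hby : b y = 1) (hbv : b v = 0) (hfill : ∀ s, y < s → s < v → b s = 1)
    (hb'y : b' y = 0) (hb'v : b' v = 1) (hb' : ∀ s, s ≠ y → s ≠ v → b' s = b s) (s : ℕ) :
    (park b' N s = N s ∨ park b' N s = N s + 1 ∧ y < s ∧ s ≤ v) ∧
    (park b' N (s + 1) = N (s + 1) + 1 →
      N s = N (s + 1) + 1 ∧ (s = y ∨ park b' N s = N s + 1)) := by
  have key : (park b' N s = N s ∨ park b' N s = N s + 1 ∧ y < s ∧ s ≤ v) := by
    induction s with
    | zero => exact Or.inl rfl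
    | succ s ih =>
      have h1 := hN s
      have h2 := hNb s
      rw [park_succ]
      rcases eq_or_ne s y with rfl | h
      · omega
      · rcases eq_or_ne s v with rfl | h'
        · omega
        · rw [hb' s h h']
          by_cases h3 : y < s ∧ s < v
          · have := hfill s h3.1 h3.2
            omega
          · omega
  refine ⟨key, fun h => ?_⟩
  have h1 := hN s
  have h2 := hNb s
  rw [park_succ] at h
  rcases eq_or_ne s y with rfl | hy
  · omega
  · rcases eq_or_ne s v with rfl | h'
    · omega
    · rw [hb' s hy h'] at h
      by_cases h3 : y < s ∧ s < v
      · have := hfill s h3.1 h3.2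
        omega
      · omega

/-- If one car's preference is moved from a position `y` without a spot up to the first position
above `y` that no car prefers (`hstep`), then the occupied spots stay the same: in between, the queue
of waiting cars never becomes empty. -/
theorem park_eq_of_raised {b N M : ℕ → ℕ} {y : ℕ} (hb : ∀ s, b s ≤ 1) (hby : b y = 0)
    (h0 : M 0 = N 0) (hM : ∀ s, M s = N s ∨ M s = N s + 1)
    (hstep : ∀ s, M (s + 1) = N (s + 1) + 1 →
      N s = N (s + 1) + 1 ∧ (s = y ∨ M s = N s + 1)) (s : ℕ) :
    park b M s = park b N s := by
  have key : park b M s = park b N s ∧ M s ≤ park b N s := by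
    induction s with
    | zero => exact ⟨h0, h0.le⟩
    | succ s ih =>
      obtain ⟨h1, h2⟩ := ih
      have h3 := hM (s + 1)
      have h4 := hstep s
      have h5 := hb s
      have h6 := le_park b N s
      simp only [park_succ]
      rcases h3 with h3 | h3
      · omega
      · obtain ⟨h7, h8⟩ := h4 h3
        rcases h8 with rfl | h8 <;> omega
  exact key.1

/-- One more car with preference `t`, and one more spot at `t'`, where `t'` is the first spot weakly
above `t`: the additional car parks at `t'` and the other cars park as before. -/
theorem park_insert {b b' N N' : ℕ → ℕ} {t t' : ℕ} (htt' : t ≤ t')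
    (hN' : ∀ s, N' (s + 1) ≤ N' s) (hN : ∀ s, N s = N' s + if s ≤ t then 1 else 0)
    (hfree : ∀ s, t ≤ s → s < t' → b s = 0) (hbt : b t' = 1) (hbt' : b' t' = 0)
    (hb : ∀ s, s ≠ t' → b' s = b s) (s : ℕ) :
    park b N s = park b' N' s + if s ≤ t' then 1 else 0 := by
  induction s with
  | zero => simp [park, hN 0]
  | succ s ih =>
    have h1 := hN (s + 1)
    have h2 := hN' s
    have h3 := le_park b' N' s
    simp only [park_succ]
    rcases eq_or_ne s t' with rfl | hs
    · rw [if_neg (by omega)] at h1 ⊢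
      rw [if_pos le_rfl] at ih
      omega
    · rw [hb s hs]
      by_cases h4 : s < t
      · rw [if_pos (by omega)] at h1 ih ⊢
        omega
      · rw [if_neg (by omega)] at h1
        by_cases h5 : s < t'
        · rw [if_pos (by omega)] at ih ⊢
          have := hfree s (by omega) h5
          omega
        · rw [if_neg (by omega)] at ih ⊢
          omega

/-! ### Columns -/

/-- The indicator function of column `c` of `U`. -/
def cell (U : Diagram) (c s : ℕ) : ℕ := if (s, c) ∈ U then 1 else 0

/-- The number of cells of `U` in column `c`, in row `s` or above. -/
def colCount (U : Diagram) (c s : ℕ) : ℕ := (rowsAbove U s c).card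

theorem cell_le_one (U : Diagram) (c s : ℕ) : cell U c s ≤ 1 := by
  unfold cell; split_ifs <;> omega

theorem cell_eq_one {U : Diagram} {c s : ℕ} : cell U c s = 1 ↔ (s, c) ∈ U := by
  unfold cell; split_ifs <;> simp_all

theorem cell_eq_zero {U : Diagram} {c s : ℕ} : cell U c s = 0 ↔ (s, c) ∉ U := by
  unfold cell; split_ifs <;> simp_all

theorem colCount_succ (U : Diagram) (c s : ℕ) :
    colCount U c s = colCount U c (s + 1) + cell U c s := by
  unfold colCount cell
  split_ifs with h
  · have e : rowsAbove U s c = insert s (rowsAbove U (s + 1) c) := by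
      ext t
      simp only [Finset.mem_insert, mem_rowsAbove]
      constructor
      · rintro ⟨h1, h2⟩
        rcases h2.eq_or_lt with h3 | h3
        · exact Or.inl h3.symm
        · exact Or.inr ⟨h1, h3⟩
      · rintro (rfl | h1)
        · exact ⟨h, le_rfl⟩
        · exact ⟨h1.1, by omega⟩
    rw [e, Finset.card_insert_of_notMem]
    simp [mem_rowsAbove]
  · rw [add_zero]
    congr 1
    ext t
    simp only [mem_rowsAbove]
    constructor
    · rintro ⟨h1, h2⟩
      refine ⟨h1, ?_⟩
      rcases h2.eq_or_lt with h3 | h3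
      · subst h3; exact absurd h1 h
      · exact h3
    · rintro ⟨h1, h2⟩
      exact ⟨h1, by omega⟩

/-- A strict bound for the rows of the cells of `U`. -/
def rowBound (U : Diagram) : ℕ := U.sup Prod.fst + 1

theorem lt_rowBound {U : Diagram} {r c : ℕ} (h : (r, c) ∈ U) : r < rowBound U :=
  Nat.lt_succ_of_le (Finset.le_sup (f := Prod.fst) h)

theorem colCount_eq_zero_iff {U : Diagram} {c s : ℕ} :
    colCount U c s = 0 ↔ ∀ r, s ≤ r → (r, c) ∉ U := by
  rw [colCount, Finset.card_eq_zero, Finset.eq_empty_iff_forall_notMem]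
  simp only [mem_rowsAbove]
  exact ⟨fun h r h1 h2 => h r ⟨h2, h1⟩, fun h r h1 => h r h1.2 h1.1⟩

theorem colCount_of_rowBound_le {U : Diagram} {c s : ℕ} (h : rowBound U ≤ s) :
    colCount U c s = 0 :=
  colCount_eq_zero_iff.2 fun r hr h1 => by have := lt_rowBound h1; omega

/-- Two functions that vanish eventually and have the same decrements agree. -/
theorem eq_of_decrements {f g b : ℕ → ℕ} {n : ℕ} (hf : ∀ s, f s = f (s + 1) + b s)
    (hg : ∀ s, g s = g (s + 1) + b s) (h : ∀ s, n ≤ s → f s = g s) (s : ℕ) : f s = g s := by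
  rcases le_total n s with hs | hs
  · exact h s hs
  · induction hs using Nat.decreasingInduction with
    | self => exact h n le_rfl
    | of_succ k hk ih => rw [hf, hg, ih]

/-- Above each height, every column has at least as many cells as the next column on its right.
This characterizes the rectified diagrams: see `IsRectified.rect` and `Rect.reflTransGen`. -/
def Rect (U : Diagram) : Prop := ∀ c s, colCount U (c + 1) s ≤ colCount U c s

theorem IsRectified.rect {U : Diagram} (h : IsRectified U) : Rect U :=
  fun c s => h.card_rowsAbove_le s c

/-! ### Key counts -/

/-- For rectified `U`, `keyCount U j c s` is the number of cells of `U` in column `c`, in row `s` or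
above, that lie on a thread beginning in column `c + j` or further right. Such threads are extracted before all
others, so their cells in column `c` are the spots taken when their cells in column `c + 1` are
parked in column `c`. -/
def keyCount (U : Diagram) : ℕ → ℕ → ℕ → ℕ
  | 0, c => colCount U c
  | j + 1, c => park (cell U c) (keyCount U j (c + 1))

theorem keyCount_zero (U : Diagram) (c : ℕ) : keyCount U 0 c = colCount U c := rfl

theorem keyCount_succ (U : Diagram) (j c : ℕ) :
    keyCount U (j + 1) c = park (cell U c) (keyCount U j (c + 1)) := rfl

theorem keyCount_le_succ_add (U : Diagram) (j c s : ℕ) :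
    keyCount U j c s ≤ keyCount U j c (s + 1) + cell U c s := by
  cases j with
  | zero => exact (colCount_succ U c s).le
  | succ j => exact park_le_succ_add _ _ s

theorem keyCount_antitone (U : Diagram) (j c s : ℕ) :
    keyCount U j c (s + 1) ≤ keyCount U j c s := by
  induction j generalizing c s with
  | zero => have := colCount_succ U c s; simp only [keyCount_zero]; omega
  | succ j ih => exact park_antitone (ih (c + 1)) s

theorem Rect.keyCount_le {U : Diagram} (hU : Rect U) (j c s : ℕ) :
    keyCount U j c s ≤ colCount U c s := by
  induction j generalizing c s with
  | zero => exact le_rfl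
  | succ j ih =>
    exact park_le (fun s => (ih (c + 1) s).trans (hU c s)) (colCount_succ U c) s

theorem keyCount_apply_zero (U : Diagram) (j c : ℕ) :
    keyCount U j c 0 = colCount U (c + j) 0 := by
  induction j generalizing c with
  | zero => rfl
  | succ j ih =>
    rw [keyCount_succ, park, ih]; congr 1; omega

/-- Key counts only depend on the columns involved. -/
theorem keyCount_congr {U V : Diagram} {j c : ℕ}
    (h : ∀ d, c ≤ d → d ≤ c + j → ∀ s, (s, d) ∈ U ↔ (s, d) ∈ V) : keyCount U j c = keyCount V j c := by
  induction j generalizing c with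
  | zero =>
    funext s
    simp only [keyCount_zero, colCount]
    congr 1
    ext t
    simp only [mem_rowsAbove, h c le_rfl (by omega)]
  | succ j ih =>
    rw [keyCount_succ, keyCount_succ, ih fun d h1 h2 => h d (by omega) (by omega)]
    congr 1
    funext s
    simp only [cell, h c le_rfl (by omega)]

theorem colCount_congr {U V : Diagram} {c : ℕ} (h : ∀ s, (s, c) ∈ U ↔ (s, c) ∈ V) :
    colCount U c = colCount V c :=
  keyCount_congr (j := 0) fun d h1 h2 => by
    obtain rfl : d = c := by omega
    exact h

/-- If `U` and `V` agree in the columns to the left of column `c`, inequalities between key counts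
pass from column `c` to column `0`. -/
theorem keyCount_left_mono {U V : Diagram} {c : ℕ} (hUV : ∀ d, d < c → ∀ s, (s, d) ∈ U ↔ (s, d) ∈ V)
    {j : ℕ} (h : ∀ s, keyCount U j c s ≤ keyCount V j c s) (s : ℕ) :
    keyCount U (c + j) 0 s ≤ keyCount V (c + j) 0 s := by
  have key : ∀ i, i ≤ c → ∀ s, keyCount U (i + j) (c - i) s ≤ keyCount V (i + j) (c - i) s := by
    intro i
    induction i with
    | zero => intro _ s; simpa using h s
    | succ i ih =>
      intro hi s
      have e : cell U (c - (i + 1)) = cell V (c - (i + 1)) := by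
        funext s
        simp only [cell, hUV (c - (i + 1)) (by omega)]
      have e2 : c - (i + 1) + 1 = c - i := by omega
      rw [show i + 1 + j = (i + j) + 1 by omega, keyCount_succ, keyCount_succ, e, e2]
      exact park_mono _ (ih (by omega)) s
  simpa using key c le_rfl s

/-! ### Kohnert moves and key counts -/

theorem mem_drop {V : Diagram} {c v y s d : ℕ} :
    (s, d) ∈ insert (y, c) (V.erase (v, c)) ↔
      (d = c ∧ s = y) ∨ (¬(d = c ∧ s = v) ∧ (s, d) ∈ V) := by
  simp only [Finset.mem_insert, Finset.mem_erase, Prod.mk.injEq, ne_eq]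
  tauto

theorem colCount_drop {V : Diagram} {c v y : ℕ} (hyv : y < v) (hv : (v, c) ∈ V)
    (hy : (y, c) ∉ V) (s : ℕ) :
    colCount V c s = colCount (insert (y, c) (V.erase (v, c))) c s +
      if y < s ∧ s ≤ v then 1 else 0 := by
  set U := insert (y, c) (V.erase (v, c)) with hU
  refine eq_of_decrements (n := max (rowBound U) (rowBound V))
    (g := fun s => colCount U c s + if y < s ∧ s ≤ v then 1 else 0)
    (colCount_succ V c) (fun s => ?_) (fun s hs => ?_) s
  · have h1 : cell U c s + (if y < s ∧ s ≤ v then 1 else 0) =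
        (if y < s + 1 ∧ s + 1 ≤ v then 1 else 0) + cell V c s := by
      rcases eq_or_ne s y with rfl | h
      · rw [cell_eq_zero.2 hy, cell_eq_one.2 (by rw [hU, mem_drop]; tauto), if_neg (by omega),
          if_pos (by omega)]
      · rcases eq_or_ne s v with rfl | h'
        · rw [cell_eq_one.2 hv, cell_eq_zero.2 (by rw [hU, mem_drop]; tauto), if_pos (by omega),
            if_neg (by omega)]
        · have : cell U c s = cell V c s := by
            simp only [cell, hU, mem_drop]
            congr 1
            simp [h, h']
          rw [this, add_comm]
          congr 1
          apply if_congr _ rfl rfl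
          omega
    have := colCount_succ U c s
    omega
  · have h1 : ¬ s ≤ v := by have := lt_rowBound hv; omega
    simp only [h1, and_false, if_false, add_zero]
    rw [colCount_of_rowBound_le (by omega), colCount_of_rowBound_le (by omega)]

/-- Kohnert moves decrease all key counts. -/
theorem KohnertMove.keyCount_le {T T' : Diagram} (h : KohnertMove T T') (d s : ℕ) :
    keyCount T' d 0 s ≤ keyCount T d 0 s := by
  obtain ⟨r, c, r', hr, hright, hr', hvac, hfill, rfl⟩ := h
  set T' := insert (r', c) (T.erase (r, c)) with hT'
  have other : ∀ e, e ≠ c → ∀ s, (s, e) ∈ T' ↔ (s, e) ∈ T := by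
    intro e he s
    rw [hT', mem_drop]; simp [he]
  rcases lt_or_ge d c with hd | hd
  · rw [keyCount_congr fun e _ he => other e (by omega)]
  · obtain ⟨j, rfl⟩ := Nat.exists_eq_add_of_le hd
    apply keyCount_left_mono fun e he => other e (by omega)
    intro s
    cases j with
    | zero =>
      rw [keyCount_zero, keyCount_zero, colCount_drop hr' hr hvac]
      exact Nat.le_add_right _ _
    | succ j =>
      rw [keyCount_succ, keyCount_succ, keyCount_congr fun e he _ => other e (by omega)]
      refine park_lower_slot hr' (keyCount_antitone T j (c + 1)) (fun s => ?_) ?_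
        (cell_eq_one.2 hr) (cell_eq_zero.2 hvac)
        (fun s h1 h2 => cell_eq_one.2 (hfill s h1 h2)) (cell_eq_zero.2 ?_) (cell_eq_one.2 ?_) ?_ s
      · have := keyCount_le_succ_add T j (c + 1) s
        have := cell_le_one T (c + 1) s
        omega
      · have h1 := keyCount_le_succ_add T j (c + 1) r
        have h2 := keyCount_antitone T j (c + 1) r
        rw [cell_eq_zero.2 (hright (c + 1) (by omega))] at h1
        omega
      · rw [hT', mem_drop]
        rintro (h | h)
        · omega
        · exact h.1 ⟨rfl, rfl⟩
      · rw [hT', mem_drop]; exact Or.inl ⟨rfl, rfl⟩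
      · intro s h1 h2
        simp only [cell, hT', mem_drop]
        congr 1
        simp [h1, h2]

theorem KohnertMove.colCount_zero_eq {T T' : Diagram} (h : KohnertMove T T') (d : ℕ) :
    colCount T' d 0 = colCount T d 0 := by
  obtain ⟨r, c, r', hr, hright, hr', hvac, hfill, rfl⟩ := h
  rcases eq_or_ne d c with rfl | hd
  · have := colCount_drop hr' hr hvac 0
    simpa using this.symm
  · rw [colCount_congr fun s => ?_]
    rw [mem_drop]; simp [hd]

/-- From column `c` on, the set of rows of each column contains that of the next column. -/
def Nested (T : Diagram) (c : ℕ) : Prop := ∀ d, c ≤ d → ∀ s, (s, d + 1) ∈ T → (s, d) ∈ T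

theorem Nested.cell_le {T : Diagram} {c : ℕ} (h : Nested T c) {d e s : ℕ} (hd : c ≤ d)
    (hde : d ≤ e) : cell T e s ≤ cell T d s := by
  induction e, hde using Nat.le_induction with
  | base => exact le_rfl
  | succ e he ih =>
    refine le_trans ?_ ih
    by_cases h1 : (s, e + 1) ∈ T
    · rw [cell_eq_one.2 h1, cell_eq_one.2 (h e (by omega) s h1)]
    · rw [cell_eq_zero.2 h1]; omega

theorem Nested.keyCount_eq {T : Diagram} {c : ℕ} (h : Nested T c) (j : ℕ) {d : ℕ} (hd : c ≤ d)
    (s : ℕ) : keyCount T j d s = colCount T (d + j) s := by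
  induction j generalizing d s with
  | zero => rfl
  | succ j ih =>
    rw [keyCount_succ, show keyCount T j (d + 1) = colCount T (d + 1 + j) from
      funext fun s => ih (by omega) s, show d + (j + 1) = d + 1 + j by omega]
    refine park_eq_self (fun s => ?_) s
    have := colCount_succ T (d + 1 + j) s
    have := h.cell_le (s := s) hd (show d ≤ d + 1 + j by omega)
    omega

theorem exists_last_not_nested {T : Diagram} (h : ¬ Nested T 0) :
    ∃ c y, Nested T (c + 1) ∧ (y, c + 1) ∈ T ∧ (y, c) ∉ T := by
  classical
  let P : ℕ → Prop := fun c => ∃ y, (y, c + 1) ∈ T ∧ (y, c) ∉ T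
  have hb : ∀ c, P c → c ≤ lastCol T := by
    rintro c ⟨y, hy, -⟩
    have : c + 1 ≤ lastCol T := Finset.le_sup (f := Prod.snd) hy
    omega
  have h1 : ∃ c, P c := by
    unfold Nested at h
    push Not at h
    obtain ⟨d, -, s, h2, h3⟩ := h
    exact ⟨d, s, h2, h3⟩
  obtain ⟨c0, hc0⟩ := h1
  have h2 : P (Nat.findGreatest P (lastCol T)) := Nat.findGreatest_spec (hb c0 hc0) hc0
  obtain ⟨y, h3, h4⟩ := h2
  refine ⟨_, y, fun d hd s hs => ?_, h3, h4⟩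
  by_contra h5
  have h6 : P d := ⟨s, hs, h5⟩
  have := Nat.le_findGreatest (hb d h6) h6
  omega

/-- A rectified diagram that is not left justified arises by a Kohnert move from a rectified
diagram with the same key counts. The move is undone in the last column `c + 1` that is not contained
in the column on its left: a cell of that column with no cell directly to its left is raised to the
first vacant position, where there is nothing on its right because the columns from `c + 1` on are
nested. -/
theorem Rect.exists_kohnertMove {T : Diagram} (hT : Rect T) (h : ¬ Nested T 0) :
    ∃ c v y, y < v ∧ (y, c) ∈ T ∧ (v, c) ∉ T ∧
      KohnertMove (insert (v, c) (T.erase (y, c))) T ∧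
      Rect (insert (v, c) (T.erase (y, c))) ∧
      ∀ d s, keyCount (insert (v, c) (T.erase (y, c))) d 0 s = keyCount T d 0 s := by
  obtain ⟨c, y, hnest, hy, hyc⟩ := exists_last_not_nested h
  have hex : ∃ v, y < v ∧ (v, c + 1) ∉ T :=
    ⟨max (y + 1) (rowBound T), by omega, fun h => by have := lt_rowBound h; omega⟩
  classical
  obtain ⟨v, ⟨hyv, hv⟩, hmin⟩ : ∃ v, (y < v ∧ (v, c + 1) ∉ T) ∧
      ∀ s, y < s → s < v → (s, c + 1) ∈ T := by
    refine ⟨Nat.find hex, Nat.find_spec hex, fun s h1 h2 => ?_⟩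
    have := Nat.find_min hex h2
    tauto
  have hback : insert (y, c + 1) ((insert (v, c + 1) (T.erase (y, c + 1))).erase (v, c + 1)) = T := by
    rw [Finset.erase_insert (by simp [hv]), Finset.insert_erase hy]
  set V := insert (v, c + 1) (T.erase (y, c + 1)) with hV
  have hvV : (v, c + 1) ∈ V := by rw [hV, mem_drop]; tauto
  have hyV : (y, c + 1) ∉ V := by
    rw [hV, mem_drop]
    rintro (h | h)
    · omega
    · exact h.1 ⟨rfl, rfl⟩
  have other : ∀ e, e ≠ c + 1 → ∀ s, (s, e) ∈ V ↔ (s, e) ∈ T := by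
    intro e he s
    rw [hV, mem_drop]; simp [he]
  have othercell : ∀ s, s ≠ y → s ≠ v → cell V (c + 1) s = cell T (c + 1) s := by
    intro s h1 h2
    simp only [cell, hV, mem_drop]
    congr 1
    simp [h1, h2]
  have hcount : ∀ s, colCount V (c + 1) s =
      colCount T (c + 1) s + if y < s ∧ s ≤ v then 1 else 0 := by
    intro s
    have := colCount_drop hyv hvV hyV s
    rwa [hback] at this
  -- parking the raised column `c + 1` into column `c` yields the same key counts
  have hpark : ∀ j s, keyCount V (j + 1) c s = keyCount T (j + 1) c s := by
    intro j
    have hc : cell V c = cell T c := by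
      funext s; simp only [cell, other c (by omega) s]
    rw [keyCount_succ, keyCount_succ, hc]
    cases j with
    | zero =>
      rw [keyCount_zero, keyCount_zero]
      have h1 := hcount
      refine park_eq_of_raised (y := y) (cell_le_one T c) (cell_eq_zero.2 hyc) ?_
        (fun s => ?_) (fun s hs => ?_)
      · simpa using h1 0
      · have := h1 s
        split_ifs at this <;> omega
      · have h2 := h1 s
        have h3 := h1 (s + 1)
        have h4 := colCount_succ T (c + 1) s
        split_ifs at h3 with h5
        · rcases eq_or_ne s y with rfl | h6
          · rw [cell_eq_one.2 hy] at h4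
            exact ⟨h4, Or.inl rfl⟩
          · rw [cell_eq_one.2 (hmin s (by omega) (by omega))] at h4
            rw [if_pos (by omega)] at h2
            exact ⟨h4, Or.inr h2⟩
        · omega
    | succ j =>
      have hF : keyCount T j (c + 1 + 1) = colCount T (c + 1 + 1 + j) :=
        funext fun s => hnest.keyCount_eq j (by omega) s
      have hP : keyCount T (j + 1) (c + 1) = colCount T (c + 1 + 1 + j) :=
        funext fun s => by rw [hnest.keyCount_eq (j + 1) le_rfl s]; congr 1; omega
      have hV2 : keyCount V (j + 1) (c + 1) =
          park (cell V (c + 1)) (colCount T (c + 1 + 1 + j)) := by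
        rw [keyCount_succ, keyCount_congr fun e he _ => other e (by omega), hF]
      rw [hP, hV2]
      have hle := fun s => hnest.cell_le (s := s) le_rfl (show c + 1 ≤ c + 1 + 1 + j by omega)
      have h1 : ∀ s, _ := fun s => park_raise_slot (b := cell T (c + 1)) (b' := cell V (c + 1))
        (N := colCount T (c + 1 + 1 + j)) hyv
        (fun s => by
          have := colCount_succ T (c + 1 + 1 + j) s
          have := cell_le_one T (c + 1 + 1 + j) s
          omega)
        (fun s => by
          have := colCount_succ T (c + 1 + 1 + j) s
          have := hle s
          omega)
        (cell_eq_one.2 hy) (cell_eq_zero.2 hv) (fun s h1 h2 => cell_eq_one.2 (hmin s h1 h2))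
        (cell_eq_zero.2 hyV) (cell_eq_one.2 hvV) othercell s
      refine park_eq_of_raised (y := y) (cell_le_one T c) (cell_eq_zero.2 hyc) rfl
        (fun s => ?_) (fun s => (h1 s).2)
      have := (h1 s).1
      tauto
  have hkey : ∀ d s, keyCount V d 0 s = keyCount T d 0 s := by
    intro d s
    rcases Nat.lt_or_ge c d with hd | hd
    · obtain ⟨j, rfl⟩ := Nat.exists_eq_add_of_le (Nat.succ_le_of_lt hd)
      rw [show c.succ + j = c + (j + 1) by omega]
      apply le_antisymm
      · exact keyCount_left_mono (fun e he => other e (by omega)) (fun s => (hpark j s).le) s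
      · exact keyCount_left_mono (fun e he s => (other e (by omega) s).symm)
          (fun s => (hpark j s).ge) s
    · rw [keyCount_congr fun e _ he => other e (by omega)]
  refine ⟨c + 1, v, y, hyv, hy, hv, ⟨v, c + 1, y, hvV, fun d hd h1 => hv ?_, hyv, hyV,
    fun s h1 h2 => ?_, hback.symm⟩, fun d s => ?_, hkey⟩
  · have h2 := (other d (by omega) v).1 h1
    have h3 := hnest.cell_le (s := v) le_rfl hd.le
    rw [cell_eq_one.2 h2] at h3
    exact cell_eq_one.1 (le_antisymm (cell_le_one _ _ _) h3)
  · rw [mem_drop]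
    exact Or.inr ⟨by omega, hmin s h1 h2⟩
  · rcases eq_or_ne d c with rfl | h1
    · rw [colCount_congr (other d (by omega))]
      calc colCount V (d + 1) s ≤ keyCount V 1 d s := le_park _ _ s
        _ = keyCount T 1 d s := hpark 0 s
        _ ≤ colCount T d s := hT.keyCount_le 1 d s
    · rcases eq_or_ne d (c + 1) with rfl | h2
      · rw [colCount_congr (other (c + 1 + 1) (by omega)), hcount]
        exact (hT (c + 1) s).trans (Nat.le_add_right _ _)
      · rw [colCount_congr (other d h2), colCount_congr (other (d + 1) (by omega))]
        exact hT d s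

/-! ### Counting large parts -/

/-- The number of parts `≥ e` of `α` in position `s` or later. -/
def partCount {m : ℕ} (α : Fin m → ℕ) (e s : ℕ) : ℕ :=
  (Finset.univ.filter fun k : Fin m => s ≤ k ∧ e ≤ α k).card

theorem parts_coe {m : ℕ} (α : Fin m → ℕ) (k : Fin m) : parts α k = α k := by
  simp [parts]

theorem parts_of_le {m : ℕ} (α : Fin m → ℕ) {k : ℕ} (h : m ≤ k) : parts α k = 0 := by
  simp [parts, Nat.not_lt.2 h]

theorem parts_injective {m : ℕ} : Function.Injective (parts : (Fin m → ℕ) → ℕ → ℕ) := by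
  intro α β h
  funext k
  rw [← parts_coe α, ← parts_coe β, h]

theorem partCount_zero {m : ℕ} (α β : Fin m → ℕ) (s : ℕ) : partCount α 0 s = partCount β 0 s := by
  simp [partCount]

theorem partCount_of_le {m : ℕ} (α : Fin m → ℕ) (e : ℕ) {s : ℕ} (h : m ≤ s) :
    partCount α e s = 0 := by
  rw [partCount, Finset.card_eq_zero, Finset.filter_eq_empty_iff]
  intro k _ h1
  have := k.2
  omega

theorem partCount_split {m : ℕ} (α : Fin m → ℕ) (e : ℕ) {s t : ℕ} (h : s ≤ t) :
    partCount α e s =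
      (Finset.univ.filter fun k : Fin m => s ≤ k ∧ k < t ∧ e ≤ α k).card + partCount α e t := by
  rw [partCount, partCount, ← Finset.card_filter_add_card_filter_not (fun k : Fin m => (k : ℕ) < t),
    Finset.filter_filter, Finset.filter_filter]
  congr 2
  · ext k; simp; tauto
  · ext k; simp; omega

theorem partCount_coe {m : ℕ} (α : Fin m → ℕ) (e : ℕ) (k : Fin m) :
    partCount α e k = partCount α e (k + 1) + if e ≤ α k then 1 else 0 := by
  rw [partCount_split α e (Nat.le_succ (k : ℕ)), add_comm]
  congr 1
  split_ifs with h
  · rw [Finset.card_eq_one]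
    refine ⟨k, ?_⟩
    ext l
    simp only [Finset.mem_filter, Finset.mem_univ, true_and, Finset.mem_singleton, Fin.ext_iff]
    constructor
    · omega
    · intro h1
      have h2 : l = k := Fin.ext h1
      subst h2
      exact ⟨le_rfl, by omega, h⟩
  · rw [Finset.card_eq_zero, Finset.filter_eq_empty_iff]
    rintro l _ ⟨h1, h2, h3⟩
    have h4 : l = k := Fin.ext (by omega)
    subst h4
    exact h h3

theorem partCount_succ {m : ℕ} (α : Fin m → ℕ) {e : ℕ} (he : 0 < e) (s : ℕ) :
    partCount α e s = partCount α e (s + 1) + if e ≤ parts α s then 1 else 0 := by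
  rcases lt_or_ge s m with h | h
  · have := partCount_coe α e ⟨s, h⟩
    simpa [parts, h] using this
  · rw [partCount_of_le α e h, partCount_of_le α e (by omega), parts_of_le α h, if_neg (by omega)]

theorem eq_of_partCount {m : ℕ} {α β : Fin m → ℕ} (h : ∀ e s, partCount α e s = partCount β e s) :
    α = β := by
  funext k
  have key : ∀ e, e ≤ α k ↔ e ≤ β k := by
    intro e
    have h1 := partCount_coe α e k
    have h2 := partCount_coe β e k
    rw [h, h] at h1
    split_ifs at h1 h2 <;> first | tauto | omega
  exact le_antisymm ((key _).1 le_rfl) ((key _).2 le_rfl)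

theorem colCount_compDiagram {m : ℕ} (α : Fin m → ℕ) (c s : ℕ) :
    colCount (compDiagram α) c s = partCount α (c + 1) s := by
  refine eq_of_decrements (n := max m (rowBound (compDiagram α)))
    (b := fun s => if c + 1 ≤ parts α s then 1 else 0) (fun s => ?_)
    (partCount_succ α (Nat.succ_pos c)) (fun s hs => ?_) s
  · rw [colCount_succ]
    simp only [cell, mem_compDiagram, Nat.succ_le_iff]
  · rw [colCount_of_rowBound_le (by omega), partCount_of_le α _ (by omega)]

/-! ### The tableau criterion for left swaps -/

/-- `α` lies below `β` if, for each threshold `e`, the positions of the parts `≥ e` of `α` are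
bounded entry by entry by those of `β`. -/
def KeyLE {m : ℕ} (α β : Fin m → ℕ) : Prop :=
  (∀ e s, partCount α e s ≤ partCount β e s) ∧ ∀ e, partCount α e 0 = partCount β e 0

theorem KeyLE.refl {m : ℕ} (α : Fin m → ℕ) : KeyLE α α := ⟨fun _ _ => le_rfl, fun _ => rfl⟩

theorem KeyLE.trans {m : ℕ} {α β γ : Fin m → ℕ} (h : KeyLE α β) (h' : KeyLE β γ) : KeyLE α γ :=
  ⟨fun e s => (h.1 e s).trans (h'.1 e s), fun e => (h.2 e).trans (h'.2 e)⟩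

theorem KeyLE.antisymm {m : ℕ} {α β : Fin m → ℕ} (h : KeyLE α β) (h' : KeyLE β α) : α = β :=
  eq_of_partCount fun e s => le_antisymm (h.1 e s) (h'.1 e s)

theorem partCount_swap {m : ℕ} {β : Fin m → ℕ} {i j : Fin m} (hij : i < j) (hβ : β i < β j)
    (e s : ℕ) : partCount β e s = partCount (β ∘ Equiv.swap i j) e s +
      if (i < s ∧ s ≤ j) ∧ β i < e ∧ e ≤ β j then 1 else 0 := by
  rcases Nat.eq_zero_or_pos e with rfl | he
  · rw [if_neg (by omega), add_zero]
    exact partCount_zero _ _ _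
  · have hij' : (i : ℕ) < j := hij
    refine eq_of_decrements (n := m) (g := fun s => partCount (β ∘ Equiv.swap i j) e s +
      if (i < s ∧ s ≤ j) ∧ β i < e ∧ e ≤ β j then 1 else 0) (partCount_succ β he) (fun s => ?_)
      (fun s hs => ?_) s
    · have h1 := partCount_succ (β ∘ Equiv.swap i j) he s
      rcases lt_or_ge s m with hs | hs
      · obtain ⟨k, rfl⟩ : ∃ k : Fin m, (k : ℕ) = s := ⟨⟨s, hs⟩, rfl⟩
        rw [parts_coe] at h1 ⊢
        rcases eq_or_ne k i with rfl | hi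
        · simp only [Function.comp_apply, Equiv.swap_apply_left] at h1
          split_ifs at h1 ⊢ <;> omega
        · rcases eq_or_ne k j with rfl | hj
          · simp only [Function.comp_apply, Equiv.swap_apply_right] at h1
            split_ifs at h1 ⊢ <;> omega
          · simp only [Function.comp_apply, Equiv.swap_apply_of_ne_of_ne hi hj] at h1
            have hi' : (k : ℕ) ≠ i := fun h => hi (Fin.ext h)
            have hj' : (k : ℕ) ≠ j := fun h => hj (Fin.ext h)
            split_ifs at h1 ⊢ <;> omega
      · have := j.2
        rw [parts_of_le _ hs] at h1 ⊢
        split_ifs at h1 ⊢ <;> omega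
    · have := j.2
      rw [if_neg (by omega), partCount_of_le _ _ hs, partCount_of_le _ _ hs]

theorem LeftSwap.keyLE {m : ℕ} {α β : Fin m → ℕ} (h : LeftSwap β α) : KeyLE α β := by
  obtain ⟨i, j, hij, hβ, rfl⟩ := h
  refine ⟨fun e s => ?_, fun e => ?_⟩
  · rw [partCount_swap hij hβ]
    exact Nat.le_add_right _ _
  · rw [partCount_swap hij hβ, if_neg (by omega), add_zero]

theorem SwapLE.keyLE {m : ℕ} {α β : Fin m → ℕ} (h : SwapLE α β) : KeyLE α β := by
  have h' : Relation.ReflTransGen LeftSwap β α := h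
  induction h' with
  | refl => exact KeyLE.refl β
  | tail h1 h2 ih => exact h2.keyLE.trans (ih h1)

theorem partCount_congr {m : ℕ} {α β : Fin m → ℕ} {j : Fin m} (hj : ∀ k, j < k → α k = β k)
    (e : ℕ) : partCount α e (j + 1) = partCount β e (j + 1) := by
  unfold partCount
  congr 1
  ext k
  simp only [Finset.mem_filter, Finset.mem_univ, true_and]
  constructor <;> rintro ⟨h1, h2⟩ <;> have := hj k (Nat.lt_of_succ_le h1) <;>
    exact ⟨h1, by omega⟩

/-- Strict inequality at the threshold `e`, deduced from the inequality at the threshold `α j`,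
where `j` is the last position at which `α` and `β` differ. -/
theorem partCount_lt_of_keyLE {m : ℕ} {α β : Fin m → ℕ} (h : KeyLE α β) {j : Fin m}
    (hj : ∀ k, j < k → α k = β k) {s e : ℕ} (hs : s ≤ j) (he : α j < e) (he' : e ≤ β j)
    (hk : ∀ k : Fin m, s ≤ k → k < j → α j ≤ β k → e ≤ β k) :
    partCount α e s < partCount β e s := by
  have h1 := partCount_split α e hs
  have h2 := partCount_split α (α j) hs
  have h3 := partCount_split β (α j) hs
  have h4 := partCount_split β e hs
  have h5 := partCount_coe α e j
  have h6 := partCount_coe α (α j) j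
  have h7 := partCount_coe β (α j) j
  have h8 := partCount_coe β e j
  rw [if_neg (by omega)] at h5
  rw [if_pos le_rfl] at h6
  rw [if_pos (by omega)] at h7
  rw [if_pos (by omega)] at h8
  have t1 := partCount_congr hj e
  have t2 := partCount_congr hj (α j)
  have c1 : (Finset.univ.filter fun k : Fin m => s ≤ k ∧ (k : ℕ) < j ∧ e ≤ α k).card ≤
      (Finset.univ.filter fun k : Fin m => s ≤ k ∧ (k : ℕ) < j ∧ α j ≤ α k).card := by
    apply Finset.card_le_card
    intro k
    simp only [Finset.mem_filter, Finset.mem_univ, true_and]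
    omega
  have c2 : (Finset.univ.filter fun k : Fin m => s ≤ k ∧ (k : ℕ) < j ∧ α j ≤ β k).card ≤
      (Finset.univ.filter fun k : Fin m => s ≤ k ∧ (k : ℕ) < j ∧ e ≤ β k).card := by
    apply Finset.card_le_card
    intro k
    simp only [Finset.mem_filter, Finset.mem_univ, true_and]
    rintro ⟨h1, h2, h3⟩
    exact ⟨h1, h2, hk k h1 h2 h3⟩
  have := h.1 (α j) s
  omega

/-- If `α` lies strictly below `β`, then some left swap on `β` stays above `α`. The bound
`α j ≤ β i` makes the swap pinned when `α` and `β` have the same support. -/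
theorem KeyLE.exists_swap {m : ℕ} {α β : Fin m → ℕ} (h : KeyLE α β) (hne : α ≠ β) :
    ∃ i j : Fin m, i < j ∧ α j ≤ β i ∧ α j < β j ∧ β i < β j ∧
      KeyLE α (β ∘ Equiv.swap i j) := by
  obtain ⟨k, hk⟩ := Function.ne_iff.1 hne
  -- `j` is the last position at which `α` and `β` differ
  obtain ⟨j, hj, hjmax⟩ : ∃ j, α j ≠ β j ∧ ∀ k, j < k → α k = β k := by
    obtain ⟨j, hj, hmax⟩ := (Finset.univ.filter fun k => α k ≠ β k).exists_max_image id
      ⟨k, by simpa using hk⟩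
    refine ⟨j, by simpa using hj, fun k hk => ?_⟩
    by_contra h1
    exact absurd (hmax k (by simpa using h1)) (not_le.2 hk)
  have hlt : α j < β j := by
    by_contra h1
    have h2 := h.1 (α j) j
    have h3 := partCount_coe α (α j) j
    have h4 := partCount_coe β (α j) j
    rw [if_pos le_rfl] at h3
    rw [if_neg (by omega)] at h4
    have h5 := partCount_congr hjmax (α j)
    omega
  have hex : (Finset.univ.filter fun i => i < j ∧ α j ≤ β i ∧ β i < β j).Nonempty := by
    by_contra h1
    rw [Finset.not_nonempty_iff_eq_empty, Finset.filter_eq_empty_iff] at h1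
    have := partCount_lt_of_keyLE h hjmax (Nat.zero_le _) hlt le_rfl fun k _ h2 h3 => by
      by_contra h4
      exact h1 (Finset.mem_univ k) ⟨h2, h3, by omega⟩
    exact this.ne (h.2 _)
  -- `i` is the last position before `j` whose part may be exchanged with `β j`
  obtain ⟨i, hi, hmax⟩ := Finset.exists_max_image _ id hex
  simp only [Finset.mem_filter, Finset.mem_univ, true_and, id] at hi hmax
  obtain ⟨hij, hi1, hi2⟩ := hi
  refine ⟨i, j, hij, hi1, hlt, hi2, fun e s => ?_, fun e => ?_⟩
  · have h1 := partCount_swap hij hi2 e s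
    split_ifs at h1 with h2
    · obtain ⟨⟨h3, h4⟩, h5, h6⟩ := h2
      have := partCount_lt_of_keyLE h hjmax h4 (by omega) h6 fun k h7 h8 h9 => by
        by_contra h10
        have : (k : ℕ) ≤ i := hmax k ⟨h8, h9, by omega⟩
        omega
      omega
    · have := h.1 e s
      omega
  · rw [h.2, partCount_swap hij hi2, if_neg (by omega), add_zero]

/-- The weighted sum of the parts, that is, the sum of the rows of all cells of `compDiagram β`.
Left swaps decrease it. -/
def height {m : ℕ} (β : Fin m → ℕ) : ℕ := ∑ k : Fin m, k * β k

theorem height_swap_lt {m : ℕ} {β : Fin m → ℕ} {i j : Fin m} (hij : i < j) (hβ : β i < β j) :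
    height (β ∘ Equiv.swap i j) < height β := by
  have h1 : ∀ f : Fin m → ℕ, ∑ k, f k = f i + (f j + ∑ k ∈ (Finset.univ.erase i).erase j, f k) := by
    intro f
    rw [Finset.add_sum_erase _ f (by simp [hij.ne']), Finset.add_sum_erase _ f (by simp)]
  unfold height
  rw [h1, h1 fun k => (k : ℕ) * β k]
  have h2 : ∑ k ∈ (Finset.univ.erase i).erase j, (k : ℕ) * (β ∘ Equiv.swap i j) k =
      ∑ k ∈ (Finset.univ.erase i).erase j, (k : ℕ) * β k := by
    refine Finset.sum_congr rfl fun k hk => ?_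
    simp only [Finset.mem_erase, Finset.mem_univ, and_true] at hk
    rw [Function.comp, Equiv.swap_apply_of_ne_of_ne hk.2 hk.1]
  rw [h2]
  simp only [Function.comp, Equiv.swap_apply_left, Equiv.swap_apply_right]
  have h3 : (i : ℕ) < j := hij
  nlinarith

/-- The tableau criterion. -/
theorem swapLE_iff {m : ℕ} {α β : Fin m → ℕ} : SwapLE α β ↔ KeyLE α β := by
  refine ⟨SwapLE.keyLE, fun h => ?_⟩
  induction hn : height β using Nat.strong_induction_on generalizing β with
  | _ n ih =>
    by_cases hne : α = β
    · subst hne; exact Relation.ReflTransGen.refl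
    · obtain ⟨i, j, hij, -, -, h2, h3⟩ := h.exists_swap hne
      exact Relation.ReflTransGen.head ⟨i, j, hij, h2, rfl⟩
        (ih _ (hn ▸ height_swap_lt hij h2) h3 rfl)

/-- The tableau criterion for pinned left swaps: they realize all inequalities between compositions
of the same support. -/
theorem pinnedSwapLE_iff {m : ℕ} {α β : Fin m → ℕ} :
    PinnedSwapLE α β ↔ KeyLE α β ∧ ∀ k, 0 < α k ↔ 0 < β k := by
  constructor
  · intro h
    refine ⟨h.swapLE.keyLE, ?_⟩
    have h' : Relation.ReflTransGen PinnedLeftSwap β α := h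
    induction h' with
    | refl => exact fun _ => Iff.rfl
    | tail h1 h2 ih =>
      obtain ⟨i, j, hij, h3, h4, rfl⟩ := h2
      intro k
      rw [← ih h1 k, Function.comp]
      rcases eq_or_ne k i with rfl | hi
      · rw [Equiv.swap_apply_left]; omega
      · rcases eq_or_ne k j with rfl | hj
        · rw [Equiv.swap_apply_right]; omega
        · rw [Equiv.swap_apply_of_ne_of_ne hi hj]
  · rintro ⟨h, hs⟩
    induction hn : height β using Nat.strong_induction_on generalizing β with
    | _ n ih =>
      by_cases hne : α = β
      · subst hne; exact Relation.ReflTransGen.refl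
      · obtain ⟨i, j, hij, h0, h1, h2, h3⟩ := h.exists_swap hne
        have hpos : 0 < β i := by
          have := (hs j).2 (by omega)
          omega
        refine Relation.ReflTransGen.head ⟨i, j, hij, hpos, h2, rfl⟩
          (ih _ (hn ▸ height_swap_lt hij h2) h3 (fun k => ?_) rfl)
        rw [hs k, Function.comp]
        rcases eq_or_ne k i with rfl | hi
        · rw [Equiv.swap_apply_left]; omega
        · rcases eq_or_ne k j with rfl | hj
          · rw [Equiv.swap_apply_right]; omega
          · rw [Equiv.swap_apply_of_ne_of_ne hi hj]

/-! ### Reachability -/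

/-- A cell can drop within its column to a vacant position if the rows that it visits are empty
on its right. -/
theorem reflTransGen_drop {V : Diagram} {i x c : ℕ} (hix : i < x) (hx : (x, c) ∈ V)
    (hi : (i, c) ∉ V)
    (hright : ∀ s, i < s → s ≤ x → (s = x ∨ (s, c) ∉ V) → ∀ d, c < d → (s, d) ∉ V) :
    Relation.ReflTransGen KohnertMove V (insert (i, c) (V.erase (x, c))) := by
  induction x using Nat.strong_induction_on generalizing V with
  | _ x ih =>
    obtain ⟨r, hr, hmax⟩ := ((Finset.range x).filter fun s => (s, c) ∉ V).exists_max_image id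
      ⟨i, by simp [hix, hi]⟩
    simp only [Finset.mem_filter, Finset.mem_range, id] at hr hmax
    have hir : i ≤ r := hmax i ⟨hix, hi⟩
    have hmove : KohnertMove V (insert (r, c) (V.erase (x, c))) := by
      refine ⟨x, c, r, hx, hright x hix le_rfl (Or.inl rfl), hr.1, hr.2, fun s h1 h2 => ?_, rfl⟩
      by_contra h3
      have := hmax s ⟨h2, h3⟩
      omega
    rcases hir.eq_or_lt with rfl | hir
    · exact Relation.ReflTransGen.single hmove
    · have h := ih r hr.1 (V := insert (r, c) (V.erase (x, c))) hir
        (by rw [mem_drop]; tauto)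
        (by
          rw [mem_drop]
          rintro (h | h)
          · omega
          · exact hi h.2) (by
          intro s h1 h2 h3 d hd
          rw [mem_drop] at h3 ⊢
          have h4 : (s, c) ∉ V := by
            rcases h3 with rfl | h3
            · exact hr.2
            · by_contra h4
              exact h3 (Or.inr ⟨by omega, h4⟩)
          have := hright s h1 (by omega) (Or.inr h4) d hd
          rintro (h | h)
          · omega
          · exact this h.2)
      refine Relation.ReflTransGen.head hmove ?_
      convert h using 1
      ext ⟨s, d⟩
      simp only [mem_drop]
      have := hr.2
      by_cases hd : d = c
      · subst hd
        by_cases hs : s = r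
        · subst hs; simp [this]
        · simp [hs]
      · simp [hd]

/-- A left swap on `β` is realized by Kohnert moves: the cells by which row `j` exceeds row `i` drop
to row `i` one after the other, from right to left. -/
theorem LeftSwap.reflTransGen {m : ℕ} {α β : Fin m → ℕ} (h : LeftSwap β α) :
    Relation.ReflTransGen KohnertMove (compDiagram β) (compDiagram α) := by
  obtain ⟨i, j, hij, hβ, rfl⟩ := h
  have hij' : (i : ℕ) < j := hij
  -- the last `k` cells of row `j` have been moved to row `i`
  have key : ∀ k, k ≤ β j - β i → ∃ V, Relation.ReflTransGen KohnertMove (compDiagram β) V ∧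
      ∀ r c, (r, c) ∈ V ↔ if β j - k ≤ c ∧ c < β j then r = i ∨ (r ≠ j ∧ c < parts β r)
        else c < parts β r := by
    intro k
    induction k with
    | zero =>
      intro _
      refine ⟨_, Relation.ReflTransGen.refl, fun r c => ?_⟩
      rw [if_neg (by omega), mem_compDiagram]
    | succ k ih =>
      intro hk
      obtain ⟨V, hV1, hV2⟩ := ih (by omega)
      have hi := parts_coe β i
      have hj := parts_coe β j
      set c := β j - (k + 1) with hc
      have h := reflTransGen_drop (V := V) (c := c) hij' (by rw [hV2, if_neg (by omega)]; omega)
        (by rw [hV2, if_neg (by omega)]; omega) (by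
          intro s h1 h2 h3 d hd
          rw [hV2, if_neg (by omega)] at h3
          rw [hV2]
          split_ifs with h4
          · rintro (h | ⟨h5, h6⟩) <;> omega
          · rcases h3 with rfl | h3 <;> omega)
      refine ⟨_, hV1.trans h, fun r d => ?_⟩
      rw [mem_drop, hV2]
      rcases eq_or_ne d c with rfl | hd
      · rw [if_neg (by omega), if_pos (by omega)]
        tauto
      · simp only [hd, false_and, not_false_eq_true, true_and, false_or]
        by_cases h5 : β j - k ≤ d ∧ d < β j
        · rw [if_pos h5, if_pos (by omega)]
        · rw [if_neg h5, if_neg (by omega)]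
  obtain ⟨V, hV1, hV2⟩ := key _ le_rfl
  convert hV1 using 1
  ext ⟨r, c⟩
  rw [hV2, mem_compDiagram]
  have hi := parts_coe β i
  have hj := parts_coe β j
  rcases lt_or_ge r m with hr | hr
  · obtain ⟨k, rfl⟩ : ∃ k : Fin m, (k : ℕ) = r := ⟨⟨r, hr⟩, rfl⟩
    rw [parts_coe, parts_coe, Function.comp]
    rcases eq_or_ne k i with rfl | hi
    · rw [Equiv.swap_apply_left]
      split_ifs <;> omega
    · rcases eq_or_ne k j with rfl | hj
      · rw [Equiv.swap_apply_right]
        split_ifs <;> omega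
      · rw [Equiv.swap_apply_of_ne_of_ne hi hj]
        have hi' : (k : ℕ) ≠ i := fun h => hi (Fin.ext h)
        have hj' : (k : ℕ) ≠ j := fun h => hj (Fin.ext h)
        split_ifs <;> omega
  · rw [parts_of_le _ hr, parts_of_le _ hr]
    have := i.2
    split_ifs <;> omega

theorem SwapLE.reflTransGen {m : ℕ} {α β : Fin m → ℕ} (h : SwapLE α β) :
    Relation.ReflTransGen KohnertMove (compDiagram β) (compDiagram α) := by
  have h' : Relation.ReflTransGen LeftSwap β α := h
  induction h' with
  | refl => exact Relation.ReflTransGen.refl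
  | tail h1 h2 ih => exact (ih h1).trans h2.reflTransGen

/-- `T` has key `α`: the key counts of `T` are the part counts of `α`. -/
def HasKey {m : ℕ} (T : Diagram) (α : Fin m → ℕ) : Prop :=
  ∀ d s, keyCount T d 0 s = partCount α (d + 1) s

theorem eq_of_colCount {U V : Diagram} (h : ∀ c s, colCount U c s = colCount V c s) : U = V := by
  ext ⟨s, c⟩
  have h1 := colCount_succ U c s
  have h2 := colCount_succ V c s
  rw [h, h] at h1
  rw [← cell_eq_one, ← cell_eq_one]
  omega

theorem Rect.lt_of_mem {m : ℕ} {T : Diagram} (hT : Rect T) {α : Fin m → ℕ} (h : HasKey T α)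
    {r c : ℕ} (hr : (r, c) ∈ T) : r < m := by
  by_contra h1
  have h2 : colCount T 0 r = 0 := by
    have := h 0 r
    rwa [partCount_of_le _ _ (by omega)] at this
  have h3 : colCount T c r ≤ colCount T 0 r := by
    clear hr
    induction c with
    | zero => exact le_rfl
    | succ c ih => exact (hT c r).trans ih
  exact colCount_eq_zero_iff.1 (by omega : colCount T c r = 0) r le_rfl hr

/-- A rectified diagram with key `α` is a Kohnert diagram of `α`. -/
theorem Rect.reflTransGen {m : ℕ} {T : Diagram} (hT : Rect T) {α : Fin m → ℕ} (h : HasKey T α) :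
    Relation.ReflTransGen KohnertMove (compDiagram α) T := by
  induction hn : ∑ x ∈ T, (m - x.1) using Nat.strong_induction_on generalizing T with
  | _ n ih =>
    by_cases hnest : Nested T 0
    · have e : T = compDiagram α := eq_of_colCount fun c s => by
        have h1 := h c s
        rw [hnest.keyCount_eq c le_rfl, Nat.zero_add] at h1
        rw [h1, colCount_compDiagram]
      rw [e]
    · obtain ⟨c, v, y, hyv, hy, hv, hmove, hrect, hkey⟩ := hT.exists_kohnertMove hnest
      have hkey' : HasKey (insert (v, c) (T.erase (y, c))) α := fun d s => by rw [hkey, h]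
      refine Relation.ReflTransGen.tail (ih _ ?_ hrect hkey' rfl) hmove
      have hvm : v < m := hrect.lt_of_mem hkey' (Finset.mem_insert_self _ _)
      rw [← hn, Finset.sum_insert (by simp [hv]), ← Finset.add_sum_erase T _ hy]
      omega

theorem hasKey_compDiagram {m : ℕ} (α : Fin m → ℕ) : HasKey (compDiagram α) α := by
  intro d s
  have h : Nested (compDiagram α) 0 := fun d _ s hs => by
    rw [mem_compDiagram] at hs ⊢
    omega
  rw [h.keyCount_eq d le_rfl, Nat.zero_add, colCount_compDiagram]

theorem keyCount_le_of_mem_KD {m : ℕ} {T : Diagram} {γ : Fin m → ℕ} (hT : T ∈ KD γ) (d s : ℕ) :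
    keyCount T d 0 s ≤ partCount γ (d + 1) s := by
  have hT' : Relation.ReflTransGen KohnertMove (compDiagram γ) T := hT
  clear hT
  induction hT' with
  | refl => exact (hasKey_compDiagram γ d s).le
  | tail _ h2 ih => exact (h2.keyCount_le d s).trans ih

theorem colCount_zero_of_mem_KD {m : ℕ} {T : Diagram} {γ : Fin m → ℕ} (hT : T ∈ KD γ) (d : ℕ) :
    colCount T d 0 = partCount γ (d + 1) 0 := by
  have hT' : Relation.ReflTransGen KohnertMove (compDiagram γ) T := hT
  clear hT
  induction hT' with
  | refl => exact colCount_compDiagram γ d 0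
  | tail _ h2 ih => rw [h2.colCount_zero_eq d, ih]

/-- The Kohnert diagrams of `γ` are the rectified diagrams whose key lies below `γ`. -/
theorem mem_KD_iff {m : ℕ} {T : Diagram} {α γ : Fin m → ℕ} (hT : Rect T) (h : HasKey T α) :
    T ∈ KD γ ↔ KeyLE α γ := by
  constructor
  · intro hγ
    refine ⟨fun e s => ?_, fun e => ?_⟩
    · cases e with
      | zero => exact (partCount_zero α γ s).le
      | succ d => rw [← h]; exact keyCount_le_of_mem_KD hγ d s
    · cases e with
      | zero => exact partCount_zero α γ 0
      | succ d =>
        rw [← h, keyCount_apply_zero, Nat.zero_add, colCount_zero_of_mem_KD hγ]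
  · intro hγ
    exact (swapLE_iff.2 hγ).reflTransGen.trans (hT.reflTransGen h)

/-! ### Threads -/

/-- In a rectified diagram a thread meets all columns to the left of its first cell: `p d` is
the row of its cell in column `d`. -/
theorem Rect.exists_threadPath {U : Diagram} (hU : Rect U) (c t : ℕ) (ht : (t, c) ∈ U) :
    ∃ p : ℕ → ℕ, p c = t ∧ (∀ d, d ≤ c → (p d, d) ∈ U) ∧
      (∀ d, d < c → p (d + 1) ≤ p d ∧ ∀ s, p (d + 1) ≤ s → s < p d → (s, d) ∉ U) ∧
      ∀ s d, (s, d) ∈ threadFrom U c t ↔ d ≤ c ∧ s = p d := by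
  induction c generalizing t with
  | zero =>
    refine ⟨fun _ => t, rfl, fun d hd => ?_, fun d hd => absurd hd (by omega), fun s d => ?_⟩
    · rwa [Nat.le_zero.1 hd]
    · simp [threadFrom, and_comm]
  | succ c ih =>
    have h : (rowsAbove U t c).Nonempty := by
      have h1 : 0 < colCount U (c + 1) t :=
        Finset.card_pos.2 ⟨t, mem_rowsAbove.2 ⟨ht, le_rfl⟩⟩
      exact Finset.card_pos.1 (h1.trans_le (hU c t))
    have hmin := mem_rowsAbove.1 (Finset.min'_mem _ h)
    obtain ⟨p, hp1, hp2, hp3, hp4⟩ := ih _ hmin.1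
    refine ⟨fun d => if d ≤ c then p d else t, if_neg (by omega), fun d hd => ?_, fun d hd => ?_,
      fun s d => ?_⟩
    · by_cases hd' : d ≤ c
      · simpa only [if_pos hd'] using hp2 d hd'
      · obtain rfl : d = c + 1 := by omega
        simpa only [if_neg hd'] using ht
    · simp only [if_pos (show d ≤ c by omega)]
      by_cases hd' : d + 1 ≤ c
      · simpa only [if_pos hd'] using hp3 d (by omega)
      · obtain rfl : d = c := by omega
        simp only [if_neg hd', hp1]
        refine ⟨hmin.2, fun s h1 h2 h3 => ?_⟩
        exact absurd ((rowsAbove U t d).min'_le s (mem_rowsAbove.2 ⟨h3, h1⟩)) (by omega)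
    · rw [threadFrom, dif_pos h, Finset.mem_insert, hp4, Prod.mk.injEq]
      dsimp only
      split_ifs <;> omega

theorem keyCount_eq_zero {U : Diagram} {j c : ℕ} (h : colCount U (c + j) 0 = 0) (s : ℕ) :
    keyCount U j c s = 0 := by
  have h1 : keyCount U j c s ≤ keyCount U j c 0 := antitone_nat_of_succ_le
    (keyCount_antitone U j c) (Nat.zero_le s)
  rw [keyCount_apply_zero, h] at h1
  omega

theorem colCount_eq_zero_of_lastCol_lt {U : Diagram} {c : ℕ} (h : lastCol U < c) (s : ℕ) :
    colCount U c s = 0 :=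
  colCount_eq_zero_iff.2 fun r _ h1 => by
    have : c ≤ lastCol U := Finset.le_sup (f := Prod.snd) h1
    omega

/-- Removing the first thread from a rectified diagram leaves a rectified diagram, and lowers the
key counts of column `0` by one up to the row `t` where the thread ends. -/
theorem Rect.firstThread_spec {U : Diagram} (hU : Rect U) (hne : U.Nonempty) :
    ∃ t, (t, 0) ∈ firstThread U hne ∧ (∀ s, (s, 0) ∈ firstThread U hne ↔ s = t) ∧
      (firstThread U hne).card = lastCol U + 1 ∧ Rect (U \ firstThread U hne) ∧
      ∀ d, d ≤ lastCol U → ∀ s, keyCount U d 0 s =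
        keyCount (U \ firstThread U hne) d 0 s + if s ≤ t then 1 else 0 := by
  obtain ⟨p, -, hpU, hp, hmem⟩ := hU.exists_threadPath (lastCol U) _
    (mem_rowsAbove.1 (Finset.min'_mem _ (lastCol_nonempty hne))).1
  change ∀ s d, (s, d) ∈ firstThread U hne ↔ _ at hmem
  set V := U \ firstThread U hne with hV
  have hmemV : ∀ d, d ≤ lastCol U → ∀ s, (s, d) ∈ V ↔ (s, d) ∈ U ∧ s ≠ p d := by
    intro d hd s
    rw [hV, Finset.mem_sdiff, hmem]
    tauto
  have hcell : ∀ d, d ≤ lastCol U → ∀ s, s ≠ p d → cell V d s = cell U d s := by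
    intro d hd s hs
    simp only [cell, hmemV d hd]
    congr 1
    simp [hs]
  have hcellp : ∀ d, d ≤ lastCol U → cell V d (p d) = 0 := fun d hd =>
    cell_eq_zero.2 (by rw [hmemV d hd]; tauto)
  have hkey : ∀ j d, d + j ≤ lastCol U → ∀ s, keyCount U j d s =
      keyCount V j d s + if s ≤ p d then 1 else 0 := by
    intro j
    induction j with
    | zero =>
      intro d hd s
      have hd : d ≤ lastCol U := hd
      refine eq_of_decrements (n := max (rowBound U) (rowBound V))
        (g := fun s => colCount V d s + if s ≤ p d then 1 else 0) (colCount_succ U d)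
        (fun s => ?_) (fun s hs => ?_) s
      · have h1 := colCount_succ V d s
        rcases eq_or_ne s (p d) with rfl | hs
        · rw [hcellp d hd] at h1
          rw [cell_eq_one.2 (hpU d hd), if_pos le_rfl, if_neg (by omega)]
          omega
        · rw [hcell d hd s hs] at h1
          split_ifs <;> omega
      · have := lt_rowBound (hpU d hd)
        rw [colCount_of_rowBound_le (by omega), colCount_of_rowBound_le (by omega),
          if_neg (by omega)]
    | succ j ih =>
      intro d hd s
      obtain ⟨h1, h2⟩ := hp d (by omega)
      exact park_insert h1 (keyCount_antitone V j (d + 1)) (ih (d + 1) (by omega))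
        (fun s h3 h4 => cell_eq_zero.2 (h2 s h3 h4)) (cell_eq_one.2 (hpU d (by omega)))
        (hcellp d (by omega)) (fun s hs => hcell d (by omega) s hs) s
  refine ⟨p 0, (hmem _ _).2 ⟨Nat.zero_le _, rfl⟩, fun s => ?_, ?_, fun d s => ?_, fun d hd s => ?_⟩
  · rw [hmem]; simp
  · have e : firstThread U hne = (Finset.range (lastCol U + 1)).image fun d => (p d, d) := by
      ext ⟨s, d⟩
      rw [hmem, Finset.mem_image]
      constructor
      · rintro ⟨h1, rfl⟩
        exact ⟨d, Finset.mem_range.2 (by omega), rfl⟩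
      · rintro ⟨d', h1, h2⟩
        rw [Finset.mem_range] at h1
        rw [Prod.mk.injEq] at h2
        obtain ⟨rfl, rfl⟩ := h2
        exact ⟨by omega, rfl⟩
    rw [e, Finset.card_image_of_injective _ fun a b h => (Prod.mk.inj h).2, Finset.card_range]
  · rcases lt_or_ge d (lastCol U) with hd | hd
    · have h1 := hkey 1 d (by omega) s
      have h2 := hkey 0 d (by omega) s
      have h3 := hU.keyCount_le 1 d s
      have h4 : colCount V (d + 1) s ≤ keyCount V 1 d s := le_park _ _ s
      simp only [keyCount_zero] at h2
      omega
    · have h1 : colCount V (d + 1) s = 0 := colCount_eq_zero_iff.2 fun r hr h2 =>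
        colCount_eq_zero_iff.1 (colCount_eq_zero_of_lastCol_lt (U := U) (c := d + 1) (by omega) s)
          r hr (Finset.mem_sdiff.1 h2).1
      omega
  · exact hkey d 0 (by omega) s

/-- The recursion for the thread weight that follows from extracting the first thread. -/
theorem threadWeight_of_nonempty {U : Diagram} (hne : U.Nonempty) (r : ℕ) :
    threadWeight U r = (if (r, 0) ∈ firstThread U hne then (firstThread U hne).card else 0) +
      threadWeight (U \ firstThread U hne) r := by
  rw [threadWeight, threads, dif_pos hne, List.filter_cons]
  simp only [decide_eq_true_eq]
  split_ifs with h
  · simp [threadWeight]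
  · simp [threadWeight]

/-- In a rectified diagram, `keyCount U d 0 s` is the number of threads of more than `d` cells
that end in row `s` or above. -/
theorem Rect.keyCount_succ_threadWeight {U : Diagram} (hU : Rect U) (d r : ℕ) :
    keyCount U d 0 r = keyCount U d 0 (r + 1) + if d < threadWeight U r then 1 else 0 := by
  induction hn : U.card using Nat.strong_induction_on generalizing U d r with
  | _ n ih =>
    rcases U.eq_empty_or_nonempty with rfl | hne
    · have h : ∀ s, keyCount ∅ d 0 s = 0 := keyCount_eq_zero (by simp [colCount_eq_zero_iff])
      rw [h, h, threadWeight, threads, dif_neg (by simp)]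
      simp
    · obtain ⟨t, htm, ht, hcard, hrect, hkey⟩ := hU.firstThread_spec hne
      have hw := threadWeight_of_nonempty hne r
      set V := U \ firstThread U hne with hV
      have ih' := fun d => ih _ (hn ▸ card_sdiff_firstThread_lt U hne) hrect d r rfl
      have hzero : lastCol U < d → ∀ s, keyCount U d 0 s = 0 ∧ keyCount V d 0 s = 0 := by
        intro hd s
        have h1 : colCount U (0 + d) 0 = 0 := colCount_eq_zero_of_lastCol_lt (by omega) 0
        refine ⟨keyCount_eq_zero h1 s, keyCount_eq_zero (colCount_eq_zero_iff.2 fun r hr h2 => ?_) s⟩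
        exact colCount_eq_zero_iff.1 h1 r hr (Finset.mem_sdiff.1 h2).1
      simp only [ht, hcard] at hw
      rcases eq_or_ne r t with rfl | hr
      · have h1 : threadWeight V r = 0 := by
          by_contra h2
          have h3 := ih' 0
          have h4 := keyCount_le_succ_add V 0 0 r
          rw [if_pos (by omega)] at h3
          rw [cell_eq_zero.2 fun h => (Finset.mem_sdiff.1 h).2 htm] at h4
          omega
        have h2 := ih' d
        rw [if_pos rfl, h1] at hw
        rw [h1, if_neg (by omega)] at h2
        rw [hw]
        rcases lt_or_ge (lastCol U) d with hd | hd
        · rw [(hzero hd _).1, (hzero hd _).1, if_neg (by omega)]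
        · rw [hkey d hd, hkey d hd, if_pos le_rfl, if_neg (by omega), if_pos (by omega), h2]
      · rw [if_neg hr, zero_add] at hw
        have h2 := ih' d
        rw [hw]
        rcases lt_or_ge (lastCol U) d with hd | hd
        · rw [(hzero hd _).2, (hzero hd _).2] at h2
          rw [(hzero hd _).1, (hzero hd _).1, ← h2]
        · have h3 := hkey d hd r
          have h4 := hkey d hd (r + 1)
          split_ifs at h2 h3 h4 ⊢ <;> omega

theorem threadWeight_pos_iff {U : Diagram} (hU : Rect U) {r : ℕ} :
    0 < threadWeight U r ↔ (r, 0) ∈ U := by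
  have h1 := hU.keyCount_succ_threadWeight 0 r
  have h2 := colCount_succ U 0 r
  rw [← cell_eq_one]
  simp only [keyCount_zero] at h1
  split_ifs at h1 <;> omega

/-- The key of a rectified diagram is its thread weight. -/
theorem hasKey_iff {m : ℕ} {T : Diagram} (hT : Rect T) {α : Fin m → ℕ} :
    HasKey T α ↔ threadWeight T = parts α := by
  constructor
  · intro h
    have key : ∀ d r, d < threadWeight T r ↔ d < parts α r := by
      intro d r
      have h1 := hT.keyCount_succ_threadWeight d r
      have h2 := partCount_succ α (show 0 < d + 1 by omega) r
      rw [h, h] at h1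
      split_ifs at h1 h2 <;> omega
    funext r
    exact le_antisymm (le_of_not_gt fun h1 => lt_irrefl _ ((key _ r).1 h1))
      (le_of_not_gt fun h1 => lt_irrefl _ ((key _ r).2 h1))
  · intro h d s
    refine eq_of_decrements (n := max m (rowBound T))
      (b := fun s => if d + 1 ≤ parts α s then 1 else 0) (fun s => ?_)
      (partCount_succ α (show 0 < d + 1 by omega)) (fun s hs => ?_) s
    · rw [hT.keyCount_succ_threadWeight, h]
      simp only [Nat.succ_le_iff]
    · have h1 := hT.keyCount_le d 0 s
      rw [colCount_of_rowBound_le (by omega)] at h1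
      rw [partCount_of_le α _ (by omega)]
      omega

theorem mem_AKD_iff {m : ℕ} {T : Diagram} {α : Fin m → ℕ} :
    T ∈ AKD α ↔ Rect T ∧ HasKey T α := by
  constructor
  · rintro ⟨h1, h2⟩
    exact ⟨h1.rect, (hasKey_iff h1.rect).2 h2⟩
  · rintro ⟨h1, h2⟩
    exact ⟨⟨m, α, h1.reflTransGen h2⟩, (hasKey_iff h1).1 h2⟩

theorem mem_zero_iff_of_mem_AKD {m : ℕ} {T : Diagram} {α : Fin m → ℕ} (h : T ∈ AKD α) (r : ℕ) :
    (r, 0) ∈ T ↔ 0 < parts α r := by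
  rw [← threadWeight_pos_iff h.1.rect, h.2]

theorem exists_mem_AKD {m : ℕ} {T : Diagram} {γ : Fin m → ℕ} (hT : T ∈ KD γ) :
    ∃ α : Fin m → ℕ, T ∈ AKD α := by
  have hR : IsRectified T := ⟨m, γ, hT⟩
  refine ⟨fun k => threadWeight T k, hR, ?_⟩
  funext r
  by_cases h : r < m
  · simp [parts, h]
  · rw [parts_of_le _ (by omega)]
    by_contra h1
    have h2 := (threadWeight_pos_iff hR.rect).1 (Nat.pos_of_ne_zero h1)
    have h3 := keyCount_le_of_mem_KD hT 0 r
    rw [partCount_of_le _ _ (by omega)] at h3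
    exact colCount_eq_zero_iff.1 (Nat.le_zero.1 h3) r le_rfl h2

theorem mem_KD_iff_of_mem_AKD {m : ℕ} {T : Diagram} {α γ : Fin m → ℕ} (h : T ∈ AKD α) :
    T ∈ KD γ ↔ SwapLE α γ := by
  obtain ⟨h1, h2⟩ := mem_AKD_iff.1 h
  rw [mem_KD_iff h1 h2, swapLE_iff]

theorem eq_of_mem_AKD {m : ℕ} {T : Diagram} {α β : Fin m → ℕ} (hα : T ∈ AKD α) (hβ : T ∈ AKD β) :
    α = β :=
  parts_injective (hα.2.symm.trans hβ.2)

/-! ### Proper labelings -/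

/-- The greedy assignment: `r` receives the smallest label admitted by `Q` that no smaller
element of `C` has received. -/
noncomputable def greedyLabel (C : ℕ → Prop) (Q : ℕ → ℕ → Prop) (r : ℕ) : ℕ :=
  sInf {i | Q i r ∧ ∀ s, (h : s < r) → C s → greedyLabel C Q s ≠ i}
termination_by r

theorem greedyLabel_isLeast {C : ℕ → Prop} [DecidablePred C] {Q : ℕ → ℕ → Prop} {r : ℕ}
    {A : Finset ℕ} (hA : ∀ i ∈ A, Q i r)
    (hcard : ((Finset.range r).filter C).card < A.card) :
    IsLeast {i | Q i r ∧ ∀ s, s < r → C s → greedyLabel C Q s ≠ i} (greedyLabel C Q r) := by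
  have hne : {i | Q i r ∧ ∀ s, s < r → C s → greedyLabel C Q s ≠ i}.Nonempty := by
    have h1 : (((Finset.range r).filter C).image (greedyLabel C Q)).card < A.card :=
      Finset.card_image_le.trans_lt hcard
    obtain ⟨i, hi, hi'⟩ := Finset.exists_mem_notMem_of_card_lt_card h1
    refine ⟨i, hA i hi, fun s hs hC h => hi' ?_⟩
    exact Finset.mem_image.2 ⟨s, by simp [hs, hC], h⟩
  rw [greedyLabel]
  exact ⟨Nat.sInf_mem hne, fun i hi => Nat.sInf_le hi⟩

/-- The labels of column `c`. -/
def columnLabels {m : ℕ} (α : Fin m → ℕ) (c : ℕ) : Finset ℕ :=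
  (Finset.range m).filter fun i => c < parts α i

theorem mem_columnLabels {m : ℕ} {α : Fin m → ℕ} {c i : ℕ} :
    i ∈ columnLabels α c ↔ c < parts α i := by
  rw [columnLabels, Finset.mem_filter, Finset.mem_range]
  exact ⟨fun h => h.2, fun h => ⟨lt_of_parts_pos ((Nat.zero_le c).trans_lt h), h⟩⟩

theorem card_columnLabels {m : ℕ} (α : Fin m → ℕ) (c : ℕ) :
    (columnLabels α c).card = partCount α (c + 1) 0 := by
  rw [← colCount_compDiagram, colCount]
  congr 1
  ext i
  rw [mem_columnLabels, mem_rowsAbove, mem_compDiagram]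
  simp

theorem card_range_filter_add_colCount (T : Diagram) (c r : ℕ) :
    ((Finset.range r).filter fun s => (s, c) ∈ T).card + colCount T c r = colCount T c 0 := by
  induction r with
  | zero => simp
  | succ r ih =>
    rw [Finset.range_add_one, Finset.filter_insert]
    have := colCount_succ T c r
    split_ifs with h
    · rw [cell_eq_one.2 h] at this
      rw [Finset.card_insert_of_notMem (by simp)]
      omega
    · rw [cell_eq_zero.2 h] at this
      omega

/-- The conditions of `IsProperLabeling` on column `c`. -/
def IsProperAt {m : ℕ} (α : Fin m → ℕ) (T : Diagram) (L : ℕ × ℕ → ℕ) (c : ℕ) : Prop :=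
  (∀ r, (r, c) ∈ T →
    IsLeast {i | c < parts α i ∧ (∀ s, s < r → (s, c) ∈ T → L (s, c) ≠ i) ∧
      (∀ s, (s, c + 1) ∈ T → L (s, c + 1) = i → s ≤ r)} (L (r, c))) ∧
  (∀ i, c < parts α i → ∃ r, (r, c) ∈ T ∧ L (r, c) = i)

theorem isProperLabeling_iff {m : ℕ} {α : Fin m → ℕ} {T : Diagram} {L : ℕ × ℕ → ℕ} :
    IsProperLabeling α T L ↔ ∀ c, IsProperAt α T L c :=
  ⟨fun h c => ⟨fun r => h.1 r c, h.2 c⟩, fun h => ⟨fun r c => (h c).1 r, fun c => (h c).2⟩⟩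

theorem IsProperAt.congr {m : ℕ} {α : Fin m → ℕ} {T : Diagram} {L L' : ℕ × ℕ → ℕ} {c : ℕ}
    (h : IsProperAt α T L c) (h1 : ∀ s, L' (s, c) = L (s, c))
    (h2 : ∀ s, L' (s, c + 1) = L (s, c + 1)) : IsProperAt α T L' c := by
  unfold IsProperAt
  simp only [h1, h2]
  exact h

/-- Hall's condition for the greedy choice is the rectification inequality. -/
theorem Rect.exists_isProperAt {m : ℕ} {α : Fin m → ℕ} {T : Diagram} (hT : Rect T)
    (hcol : ∀ c, colCount T c 0 = partCount α (c + 1) 0) (L : ℕ × ℕ → ℕ) (c : ℕ) :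
    ∃ L', (∀ s d, d ≠ c → L' (s, d) = L (s, d)) ∧ IsProperAt α T L' c := by
  classical
  let Q : ℕ → ℕ → Prop := fun i r =>
    c < parts α i ∧ ∀ s, (s, c + 1) ∈ T → L (s, c + 1) = i → s ≤ r
  let f := greedyLabel (fun s => (s, c) ∈ T) Q
  have hf : ∀ r, (r, c) ∈ T →
      IsLeast {i | Q i r ∧ ∀ s, s < r → (s, c) ∈ T → f s ≠ i} (f r) := by
    intro r hr
    refine greedyLabel_isLeast
      (A := columnLabels α c \ (rowsAbove T (r + 1) (c + 1)).image fun s => L (s, c + 1))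
      (fun i hi => ?_) ?_
    · rw [Finset.mem_sdiff, mem_columnLabels] at hi
      refine ⟨hi.1, fun s hs hL => ?_⟩
      by_contra h
      exact hi.2 (Finset.mem_image.2 ⟨s, mem_rowsAbove.2 ⟨hs, by omega⟩, hL⟩)
    · have h1 := Finset.le_card_sdiff
        ((rowsAbove T (r + 1) (c + 1)).image fun s => L (s, c + 1)) (columnLabels α c)
      have h2 : ((rowsAbove T (r + 1) (c + 1)).image fun s => L (s, c + 1)).card ≤
          colCount T (c + 1) (r + 1) := Finset.card_image_le
      have h3 := hT c (r + 1)
      have h4 := card_range_filter_add_colCount T c r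
      have h5 := colCount_succ T c r
      rw [card_columnLabels, ← hcol] at h1
      rw [cell_eq_one.2 hr] at h5
      omega
  have hinj : Set.InjOn f (rowsAbove T 0 c : Set ℕ) := by
    intro a ha b hb hab
    rw [Finset.mem_coe, mem_rowsAbove] at ha hb
    rcases lt_trichotomy a b with h | h | h
    · exact absurd hab ((hf b hb.1).1.2 a h ha.1)
    · exact h
    · exact absurd hab.symm ((hf a ha.1).1.2 b h hb.1)
  have himage : (rowsAbove T 0 c).image f = columnLabels α c := by
    apply Finset.eq_of_subset_of_card_le
    · intro i hi
      obtain ⟨r, hr, rfl⟩ := Finset.mem_image.1 hi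
      exact mem_columnLabels.2 (hf r (mem_rowsAbove.1 hr).1).1.1.1
    · rw [Finset.card_image_of_injOn hinj, card_columnLabels, ← hcol]
      exact le_rfl
  refine ⟨fun x => if x.2 = c then f x.1 else L x, fun s d hd => if_neg hd,
    fun r hr => ?_, fun i hi => ?_⟩
  · have h := hf r hr
    simp only [if_true, Nat.succ_ne_self, if_false]
    convert h using 1
    ext i
    simp only [Q, Set.mem_ofPred_eq]
    tauto
  · rw [← mem_columnLabels, ← himage, Finset.mem_image] at hi
    obtain ⟨r, hr, hri⟩ := hi
    exact ⟨r, (mem_rowsAbove.1 hr).1, by simpa using hri⟩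

theorem Rect.exists_isProperLabeling {m : ℕ} {α : Fin m → ℕ} {T : Diagram} (hT : Rect T)
    (hcol : ∀ c, colCount T c 0 = partCount α (c + 1) 0) : ∃ L, IsProperLabeling α T L := by
  have key : ∀ n, ∃ L, ∀ c, lastCol T < c + n → IsProperAt α T L c := by
    intro n
    induction n with
    | zero =>
      refine ⟨fun _ => 0, fun c hc => ?_⟩
      have h1 : colCount T c 0 = 0 := colCount_eq_zero_of_lastCol_lt hc 0
      refine ⟨fun r hr => absurd hr (colCount_eq_zero_iff.1 h1 r (Nat.zero_le r)), fun i hi => ?_⟩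
      rw [hcol, ← card_columnLabels, Finset.card_eq_zero] at h1
      rw [← mem_columnLabels, h1] at hi
      exact absurd hi (Finset.notMem_empty i)
    | succ n ih =>
      obtain ⟨L, hL⟩ := ih
      by_cases hn : n ≤ lastCol T
      · obtain ⟨L', h1, h2⟩ := hT.exists_isProperAt hcol L (lastCol T - n)
        refine ⟨L', fun c hc => ?_⟩
        rcases eq_or_ne c (lastCol T - n) with rfl | h3
        · exact h2
        · exact (hL c (by omega)).congr (fun s => h1 s c h3) fun s => h1 s _ (by omega)
      · exact ⟨L, fun c _ => hL c (by omega)⟩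
  obtain ⟨L, hL⟩ := key (lastCol T + 1)
  exact ⟨L, isProperLabeling_iff.2 fun c => hL c (by omega)⟩

/-- The rows, weakly above `s`, of the cells in column `c` with a label below `t`. -/
def smallRows (T : Diagram) (L : ℕ × ℕ → ℕ) (t c s : ℕ) : Finset ℕ :=
  (rowsAbove T s c).filter fun r => L (r, c) < t

theorem mem_smallRows {T : Diagram} {L : ℕ × ℕ → ℕ} {t c s r : ℕ} :
    r ∈ smallRows T L t c s ↔ (r, c) ∈ T ∧ s ≤ r ∧ L (r, c) < t := by
  rw [smallRows, Finset.mem_filter, mem_rowsAbove, and_assoc]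

/-- The labels of a proper labeling are distinct within each column. -/
theorem IsProperLabeling.injOn {m : ℕ} {α : Fin m → ℕ} {T : Diagram} {L : ℕ × ℕ → ℕ}
    (hL : IsProperLabeling α T L) {a b c : ℕ} (ha : (a, c) ∈ T) (hb : (b, c) ∈ T)
    (hab : L (a, c) = L (b, c)) : a = b := by
  rcases lt_trichotomy a b with h | h | h
  · exact absurd hab ((hL.1 b c hb).1.2.1 a h ha)
  · exact h
  · exact absurd hab.symm ((hL.1 a c ha).1.2.1 b h hb)

/-- The cells with label `< t` are parked, column by column, together with the new labels `< t` of
each column, so they cannot rise above the key counts diminished by the number of labels `≥ t`. -/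
theorem IsProperLabeling.card_smallRows_le {m : ℕ} {α : Fin m → ℕ} {T : Diagram} {L : ℕ × ℕ → ℕ}
    (hL : IsProperLabeling α T L) (t c s : ℕ) :
    (smallRows T L t c s).card = 0 ∨
      ∃ j, (smallRows T L t c s).card + partCount α (c + j + 1) t ≤ keyCount T j c s := by
  have key : ∀ n c, lastCol T < c + n → ∀ s, (smallRows T L t c s).card = 0 ∨
      ∃ j, (smallRows T L t c s).card + partCount α (c + j + 1) t ≤ keyCount T j c s := by
    intro n
    induction n with
    | zero =>
      intro c hc s
      left
      rw [Finset.card_eq_zero, Finset.eq_empty_iff_forall_notMem]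
      intro r hr
      exact colCount_eq_zero_iff.1 (colCount_eq_zero_of_lastCol_lt hc s) r
        (mem_smallRows.1 hr).2.1 (mem_smallRows.1 hr).1
    | succ n ihn =>
      intro c hc s
      have ih := ihn (c + 1) (by omega)
      induction s with
      | zero =>
        right
        refine ⟨0, ?_⟩
        rw [keyCount_zero, colCount,
          ← Finset.card_filter_add_card_filter_not (s := rowsAbove T 0 c) (fun r => L (r, c) < t)]
        refine Nat.add_le_add le_rfl ?_
        -- every label `≥ t` of column `c` is the label of some cell
        have h1 : partCount α (c + 0 + 1) t = (rowsAbove (compDiagram α) t c).card :=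
          (colCount_compDiagram α c t).symm
        rw [h1]
        refine le_trans (Finset.card_le_card fun i hi => ?_)
          (Finset.card_image_le (f := fun r => L (r, c)))
        rw [mem_rowsAbove, mem_compDiagram] at hi
        obtain ⟨r, hr, hri⟩ := hL.2 c i hi.1
        exact Finset.mem_image.2 ⟨r, Finset.mem_filter.2
          ⟨mem_rowsAbove.2 ⟨hr, Nat.zero_le r⟩, by omega⟩, hri⟩
      | succ s ihs =>
        by_cases hbig : (s, c) ∈ T ∧ t ≤ L (s, c)
        · -- no small label is available for row `s`: those used higher up occur, in column `c + 1`,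
          -- strictly above row `s`
          have h1 : (smallRows T L t c (s + 1)).card ≤ (smallRows T L t (c + 1) (s + 1)).card := by
            rw [← Finset.card_image_of_injOn (s := smallRows T L t c (s + 1))
              (f := fun r => L (r, c)) fun a ha b hb hab =>
              hL.injOn (mem_smallRows.1 ha).1 (mem_smallRows.1 hb).1 hab]
            refine le_trans (Finset.card_le_card fun i hi => ?_)
              (Finset.card_image_le (f := fun r => L (r, c + 1)))
            obtain ⟨r, hr, rfl⟩ := Finset.mem_image.1 hi
            obtain ⟨hr1, hr2, hr3⟩ := mem_smallRows.1 hr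
            have h2 := (hL.1 r c hr1).1
            have h3 : ¬ ∀ u, (u, c + 1) ∈ T → L (u, c + 1) = L (r, c) → u ≤ s := by
              intro h3
              have := (hL.1 s c hbig.1).2 ⟨h2.1, fun u hu => h2.2.1 u (by omega), h3⟩
              omega
            push Not at h3
            obtain ⟨u, hu1, hu2, hu3⟩ := h3
            exact Finset.mem_image.2 ⟨u, mem_smallRows.2 ⟨hu1, by omega, by omega⟩, hu2⟩
          rcases ih (s + 1) with h2 | ⟨j, h2⟩
          · left; omega
          · right
            refine ⟨j + 1, ?_⟩
            have h3 : keyCount T j (c + 1) (s + 1) ≤ keyCount T (j + 1) c (s + 1) := le_park _ _ _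
            rw [show c + (j + 1) + 1 = c + 1 + j + 1 by omega]
            omega
        · have h1 : (smallRows T L t c s).card = (smallRows T L t c (s + 1)).card + cell T c s := by
            by_cases hs : (s, c) ∈ T
            · have e : smallRows T L t c s = insert s (smallRows T L t c (s + 1)) := by
                ext r
                rw [Finset.mem_insert, mem_smallRows, mem_smallRows]
                constructor
                · rintro ⟨h1, h2, h3⟩
                  by_cases h4 : r = s
                  · exact Or.inl h4
                  · exact Or.inr ⟨h1, by omega, h3⟩
                · rintro (rfl | h1)
                  · exact ⟨hs, le_rfl, not_le.1 fun h => hbig ⟨hs, h⟩⟩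
                  · exact ⟨h1.1, by omega, h1.2.2⟩
              rw [e, Finset.card_insert_of_notMem (by rw [mem_smallRows]; omega),
                cell_eq_one.2 hs]
            · rw [cell_eq_zero.2 hs, add_zero]
              congr 1
              ext r
              rw [mem_smallRows, mem_smallRows]
              constructor
              · rintro ⟨h1, h2, h3⟩
                have : r ≠ s := by rintro rfl; exact hs h1
                exact ⟨h1, by omega, h3⟩
              · rintro ⟨h1, h2, h3⟩
                exact ⟨h1, by omega, h3⟩
          rcases ihs with h2 | ⟨j, h2⟩
          · left; omega
          · right
            refine ⟨j, ?_⟩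
            have := keyCount_le_succ_add T j c s
            omega
  exact key (lastCol T + 1) c (by omega) s

/-- In a proper labeling of a Kohnert diagram the labels of column `0` are at least their rows. -/
theorem IsProperLabeling.le_label {m : ℕ} {α : Fin m → ℕ} {T : Diagram} {L : ℕ × ℕ → ℕ}
    (hL : IsProperLabeling α T L) (hT : T ∈ KD α) {r : ℕ} (hr : (r, 0) ∈ T) : r ≤ L (r, 0) := by
  by_contra h
  have h1 : 0 < (smallRows T L r 0 r).card :=
    Finset.card_pos.2 ⟨r, mem_smallRows.2 ⟨hr, le_rfl, by omega⟩⟩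
  rcases hL.card_smallRows_le r 0 r with h2 | ⟨j, h2⟩
  · omega
  · have := keyCount_le_of_mem_KD hT j r
    rw [Nat.zero_add] at h2
    omega

/-- A Kohnert diagram of `α` is pinned if and only if its leftmost column is the support of `α`. -/
theorem mem_PKD_iff {m : ℕ} {α : Fin m → ℕ} {T : Diagram} :
    T ∈ PKD α ↔ T ∈ KD α ∧ ∀ r, (r, 0) ∈ T ↔ 0 < parts α r := by
  constructor
  · rintro ⟨hT, L, hL, hpin⟩
    refine ⟨hT, fun r => ⟨fun hr => ?_, fun hr => ?_⟩⟩
    · have := (hL.1 r 0 hr).1.1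
      rwa [hpin r hr] at this
    · obtain ⟨s, hs, rfl⟩ := hL.2 0 r hr
      rwa [hpin s hs]
  · rintro ⟨hT, hcol⟩
    obtain ⟨L, hL⟩ := (IsRectified.rect ⟨m, α, hT⟩).exists_isProperLabeling
      (colCount_zero_of_mem_KD hT)
    refine ⟨hT, L, hL, ?_⟩
    -- `L` permutes the rows of the leftmost column and never decreases them
    have hle : ∀ r ∈ rowsAbove T 0 0, r ≤ L (r, 0) := fun r hr =>
      hL.le_label hT (mem_rowsAbove.1 hr).1
    have himage : (rowsAbove T 0 0).image (fun r => L (r, 0)) = rowsAbove T 0 0 := by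
      ext i
      rw [Finset.mem_image, mem_rowsAbove, hcol]
      constructor
      · rintro ⟨r, hr, rfl⟩
        exact ⟨(hL.1 r 0 (mem_rowsAbove.1 hr).1).1.1, Nat.zero_le _⟩
      · rintro ⟨hi, -⟩
        obtain ⟨r, hr, hri⟩ := hL.2 0 i hi
        exact ⟨r, mem_rowsAbove.2 ⟨hr, Nat.zero_le r⟩, hri⟩
    have hsum : ∑ r ∈ rowsAbove T 0 0, r = ∑ r ∈ rowsAbove T 0 0, L (r, 0) := by
      conv_lhs => rw [← himage]
      exact Finset.sum_image fun a ha b hb hab =>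
        hL.injOn (mem_rowsAbove.1 ha).1 (mem_rowsAbove.1 hb).1 hab
    intro r hr
    exact ((Finset.sum_eq_sum_iff_of_le hle).1 hsum r
      (mem_rowsAbove.2 ⟨hr, Nat.zero_le r⟩)).symm

theorem mem_PKD_iff_of_mem_AKD {m : ℕ} {T : Diagram} {α β : Fin m → ℕ} (h : T ∈ AKD α) :
    T ∈ PKD β ↔ PinnedSwapLE α β := by
  rw [mem_PKD_iff, pinnedSwapLE_iff, mem_KD_iff_of_mem_AKD h, swapLE_iff]
  refine and_congr_right fun _ => ?_
  simp only [mem_zero_iff_of_mem_AKD h]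
  constructor
  · intro h1 k
    simpa only [parts_coe] using h1 k
  · intro h1 r
    by_cases hr : r < m
    · simpa only [parts, hr, dif_pos] using h1 ⟨r, hr⟩
    · rw [parts_of_le _ (by omega), parts_of_le _ (by omega)]

/-! ### The greatest element of a pinned class below `γ` -/

/-- The positions of the parts `≥ e` of `γ` are parked downwards in the support of `α`: each one takes
the last free position of the support weakly before it. `dropCount α γ e k` is the number of those
that end in one of the last `k` positions. -/
def dropCount {m : ℕ} (α γ : Fin m → ℕ) (e : ℕ) : ℕ → ℕ
  | 0 => 0
  | k + 1 => min (partCount γ e (m - (k + 1)))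
      (dropCount α γ e k + if 0 < parts α (m - (k + 1)) then 1 else 0)

/-- `dropCount`, as a function of the lowest position that is counted. -/
def dropAbove {m : ℕ} (α γ : Fin m → ℕ) (e s : ℕ) : ℕ := dropCount α γ e (m - s)

section

variable {m : ℕ} (α γ : Fin m → ℕ)

theorem dropAbove_of_le (e : ℕ) {s : ℕ} (hs : m ≤ s) : dropAbove α γ e s = 0 := by
  rw [dropAbove, Nat.sub_eq_zero_of_le hs, dropCount]

theorem dropAbove_succ (e s : ℕ) : dropAbove α γ e s = min (partCount γ e s)
    (dropAbove α γ e (s + 1) + if 0 < parts α s then 1 else 0) := by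
  rcases lt_or_ge s m with hs | hs
  · rw [dropAbove, dropAbove, show m - s = m - (s + 1) + 1 by omega, dropCount,
      show m - (m - (s + 1) + 1) = s by omega]
  · rw [dropAbove_of_le α γ e hs, partCount_of_le γ e hs, Nat.zero_min]

theorem dropAbove_le (e s : ℕ) : dropAbove α γ e s ≤ partCount γ e s := by
  rw [dropAbove_succ]; exact min_le_left _ _

/-- Reasoning by descending induction on positions. -/
theorem forall_of_step {P : ℕ → Prop} (h0 : ∀ s, m ≤ s → P s) (h : ∀ s, P (s + 1) → P s) (s : ℕ) :
    P s := by
  rcases le_total m s with hs | hs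
  · exact h0 s hs
  · exact Nat.decreasingInduction (fun k _ => h k) (h0 m le_rfl) hs

theorem dropAbove_antitone {e : ℕ} (he : 0 < e) (s : ℕ) :
    dropAbove α γ e (s + 1) ≤ dropAbove α γ e s := by
  have h1 := dropAbove_succ α γ e s
  have h2 := dropAbove_le α γ e (s + 1)
  have h3 := partCount_succ γ he s
  omega

theorem partCount_succ_le (e s : ℕ) : partCount γ (e + 1) s ≤ partCount γ e s := by
  apply Finset.card_le_card
  intro k
  simp only [Finset.mem_filter, Finset.mem_univ, true_and]
  omega

/-- At each position, at least as many of the parts `≥ e` as of the parts `≥ e + 1` are waiting to be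
parked. -/
theorem dropAbove_waiting {e : ℕ} (he : 0 < e) (s : ℕ) :
    partCount γ (e + 1) s + dropAbove α γ e s ≤ partCount γ e s + dropAbove α γ (e + 1) s := by
  induction s using forall_of_step (m := m) with
  | h0 s hs =>
    rw [dropAbove_of_le _ _ _ hs, dropAbove_of_le _ _ _ hs]
    exact Nat.add_le_add_right (partCount_succ_le γ e s) 0
  | h s ih =>
    have h1 := dropAbove_succ α γ e s
    have h2 := dropAbove_succ α γ (e + 1) s
    have h3 := partCount_succ γ he s
    have h4 := partCount_succ γ (show 0 < e + 1 by omega) s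
    have h5 := dropAbove_le α γ e (s + 1)
    have h6 := dropAbove_le α γ (e + 1) (s + 1)
    have h7 := partCount_succ_le γ e s
    split_ifs at h1 h2 h3 h4 <;> omega

/-- A position of the support taken at threshold `e + 1` is taken at threshold `e`. -/
theorem dropAbove_nested {e : ℕ} (he : 0 < e) {s : ℕ}
    (h : dropAbove α γ (e + 1) (s + 1) < dropAbove α γ (e + 1) s) :
    dropAbove α γ e (s + 1) < dropAbove α γ e s := by
  have h0 := dropAbove_waiting α γ he (s + 1)
  have h1 := dropAbove_succ α γ e s
  have h2 := dropAbove_succ α γ (e + 1) s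
  have h3 := partCount_succ γ he s
  have h4 := partCount_succ γ (show 0 < e + 1 by omega) s
  have h5 := dropAbove_le α γ e (s + 1)
  have h6 := dropAbove_le α γ (e + 1) (s + 1)
  split_ifs at h1 h2 h3 h4 <;> omega

theorem dropAbove_nested_of_le {e f : ℕ} (he : 0 < e) (hef : e ≤ f) {s : ℕ}
    (h : dropAbove α γ f (s + 1) < dropAbove α γ f s) :
    dropAbove α γ e (s + 1) < dropAbove α γ e s := by
  induction f, hef using Nat.le_induction with
  | base => exact h
  | succ f hf ih => exact ih (dropAbove_nested α γ (by omega) h)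

theorem dropAbove_eq_zero {e : ℕ} (he : ∑ k, γ k < e) (s : ℕ) : dropAbove α γ e s = 0 := by
  have h1 := dropAbove_le α γ e s
  have h2 : partCount γ e s = 0 := by
    rw [partCount, Finset.card_eq_zero, Finset.filter_eq_empty_iff]
    rintro k - ⟨-, hk⟩
    have := Finset.single_le_sum (f := γ) (fun _ _ => Nat.zero_le _) (Finset.mem_univ k)
    omega
  omega

/-- The composition with the support of `α` whose parts `≥ e` occupy the positions counted by
`dropAbove α γ e`. -/
noncomputable def pinnedMax (k : Fin m) : ℕ :=
  open Classical in
  Nat.findGreatest (fun e => dropAbove α γ e (k + 1) < dropAbove α γ e k) (∑ k, γ k)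

theorem le_pinnedMax_iff {e : ℕ} (he : 0 < e) (k : Fin m) :
    e ≤ pinnedMax α γ k ↔ dropAbove α γ e (k + 1) < dropAbove α γ e k := by
  classical
  constructor
  · intro h
    have h1 := Nat.findGreatest_of_ne_zero (P := fun e => dropAbove α γ e (k + 1) <
      dropAbove α γ e k) (n := ∑ k, γ k) (m := pinnedMax α γ k) (by unfold pinnedMax; congr)
      (by omega)
    exact dropAbove_nested_of_le α γ he h h1
  · intro h
    have h1 : e ≤ ∑ k, γ k := by
      by_contra h2
      rw [dropAbove_eq_zero α γ (by omega), dropAbove_eq_zero α γ (by omega)] at h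
      exact lt_irrefl _ h
    unfold pinnedMax
    convert Nat.le_findGreatest (P := fun e => dropAbove α γ e (k + 1) < dropAbove α γ e k) h1 h

theorem partCount_pinnedMax {e : ℕ} (he : 0 < e) (s : ℕ) :
    partCount (pinnedMax α γ) e s = dropAbove α γ e s := by
  induction s using forall_of_step (m := m) with
  | h0 s hs => rw [partCount_of_le _ _ hs, dropAbove_of_le _ _ _ hs]
  | h s ih =>
    rcases lt_or_ge s m with hs | hs
    · obtain ⟨k, rfl⟩ : ∃ k : Fin m, (k : ℕ) = s := ⟨⟨s, hs⟩, rfl⟩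
      have h1 := partCount_coe (pinnedMax α γ) e k
      have h2 := le_pinnedMax_iff α γ he k
      have h3 := dropAbove_succ α γ e k
      have h4 := dropAbove_antitone α γ he k
      split_ifs at h1 h3 <;> omega
    · rw [partCount_of_le _ _ hs, dropAbove_of_le _ _ _ hs]

variable {α γ}

theorem KeyLE.partCount_le_dropAbove {β : Fin m → ℕ} (h : KeyLE β γ)
    (hs : ∀ k, 0 < β k ↔ 0 < α k) {e : ℕ} (he : 0 < e) (s : ℕ) :
    partCount β e s ≤ dropAbove α γ e s := by
  induction s using forall_of_step (m := m) with
  | h0 s hs => rw [partCount_of_le _ _ hs]; exact Nat.zero_le _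
  | h s ih =>
    rw [dropAbove_succ]
    refine le_min (h.1 e s) ?_
    rw [partCount_succ β he]
    refine Nat.add_le_add ih ?_
    have h1 : 0 < parts β s → 0 < parts α s := by
      unfold parts
      split_ifs
      · exact (hs _).1
      · exact id
    split_ifs <;> omega

/-- Among the compositions below `γ` with the support of `α` there is a greatest one, provided
that `α` itself lies below `γ`. -/
theorem KeyLE.exists_greatest (h : KeyLE α γ) :
    ∃ μ : Fin m → ℕ, KeyLE μ γ ∧ (∀ k, 0 < μ k ↔ 0 < α k) ∧
      ∀ β : Fin m → ℕ, KeyLE β γ → (∀ k, 0 < β k ↔ 0 < α k) → KeyLE β μ := by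
  have htot : ∀ e, partCount (pinnedMax α γ) e 0 = partCount γ e 0 := by
    intro e
    rcases Nat.eq_zero_or_pos e with rfl | he
    · exact partCount_zero _ _ _
    · rw [partCount_pinnedMax α γ he]
      refine le_antisymm (dropAbove_le α γ e 0) ?_
      rw [← h.2]
      exact h.partCount_le_dropAbove (fun _ => Iff.rfl) he 0
  refine ⟨pinnedMax α γ, ⟨fun e s => ?_, htot⟩, fun k => ?_, fun β hβ hs => ⟨fun e s => ?_,
    fun e => (hβ.2 e).trans (htot e).symm⟩⟩
  · rcases Nat.eq_zero_or_pos e with rfl | he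
    · exact (partCount_zero _ _ _).le
    · rw [partCount_pinnedMax α γ he]; exact dropAbove_le α γ e s
  · -- at threshold `1` every position of the support is occupied
    have h1 : ∀ s, dropAbove α γ 1 s = partCount α 1 s := by
      intro s
      refine le_antisymm ?_ (h.partCount_le_dropAbove (fun _ => Iff.rfl) Nat.one_pos s)
      induction s using forall_of_step (m := m) with
      | h0 s hs => rw [dropAbove_of_le _ _ _ hs]; exact Nat.zero_le _
      | h s ih =>
        rw [dropAbove_succ, partCount_succ α Nat.one_pos]
        exact (min_le_right _ _).trans (Nat.add_le_add_right ih _)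
    have h2 := le_pinnedMax_iff α γ Nat.one_pos k
    have h3 := partCount_coe α 1 k
    rw [h1, h1] at h2
    split_ifs at h3 <;> omega
  · rcases Nat.eq_zero_or_pos e with rfl | he
    · exact (partCount_zero _ _ _).le
    · rw [partCount_pinnedMax α γ he]
      exact hβ.partCount_le_dropAbove hs he s

theorem mem_pinnedBelow {β : Fin m → ℕ} : α ∈ pinnedBelow β ↔ PinnedSwapLE α β := by
  simp [pinnedBelow]

theorem mem_pinnedMaximalBelow {β : Fin m → ℕ} : β ∈ pinnedMaximalBelow γ ↔
    SwapLE β γ ∧ ∀ α, PinnedSwapLE β α → SwapLE α γ → α = β := by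
  simp [pinnedMaximalBelow]

/-- The pinned classes of the elements of `pinnedMaximalBelow γ` partition the compositions
below `γ`. -/
theorem SwapLE.existsUnique_pinnedMaximalBelow (h : SwapLE α γ) :
    ∃! β, β ∈ pinnedMaximalBelow γ ∧ PinnedSwapLE α β := by
  obtain ⟨μ, h1, h2, h3⟩ := h.keyLE.exists_greatest
  refine ⟨μ, ⟨mem_pinnedMaximalBelow.2 ⟨swapLE_iff.2 h1, fun β h4 h5 => ?_⟩,
    pinnedSwapLE_iff.2 ⟨h3 α h.keyLE fun _ => Iff.rfl, fun k => (h2 k).symm⟩⟩, ?_⟩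
  · rw [pinnedSwapLE_iff] at h4
    exact (h3 β h5.keyLE fun k => (h4.2 k).symm.trans (h2 k)).antisymm h4.1
  · rintro β ⟨h4, h5⟩
    obtain ⟨h6, h7⟩ := mem_pinnedMaximalBelow.1 h4
    have h8 := (pinnedSwapLE_iff.1 h5).2
    refine (h7 μ (pinnedSwapLE_iff.2 ⟨h3 β h6.keyLE fun k => (h8 k).symm, fun k => ?_⟩)
      (swapLE_iff.2 h1)).symm
    rw [h2, h8]

end

/-! ### Generating polynomials -/

/-- Generating polynomials are additive over set partitions. -/
theorem genPoly_eq_sum {m : ℕ} {ι : Type*} {S : Set Diagram} (hS : S.Finite) (I : Finset ι)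
    {F : ι → Set Diagram} (hF : ∀ i, (F i).Finite) (hsub : ∀ i ∈ I, F i ⊆ S)
    (hex : ∀ T ∈ S, ∃! i, i ∈ I ∧ T ∈ F i) :
    genPoly m S hS = ∑ i ∈ I, genPoly m (F i) (hF i) := by
  classical
  unfold genPoly
  rw [← Finset.sum_biUnion]
  · congr 1
    ext T
    simp only [Set.Finite.mem_toFinset, Finset.mem_biUnion]
    constructor
    · intro hT
      obtain ⟨i, hi, -⟩ := hex T hT
      exact ⟨i, hi⟩
    · rintro ⟨i, hi, hT⟩
      exact hsub i hi hT
  · intro i hi j hj hij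
    rw [Function.onFun, Finset.disjoint_left]
    intro T h1 h2
    rw [Set.Finite.mem_toFinset] at h1 h2
    exact hij ((hex T (hsub i hi h1)).unique ⟨hi, h1⟩ ⟨hj, h2⟩)

theorem demazureCharacter_eq_sum {m : ℕ} (γ : Fin m → ℕ) :
    demazureCharacter γ = ∑ β ∈ pinnedMaximalBelow γ, pinnedPolynomial β := by
  refine genPoly_eq_sum _ _ finite_PKD (fun β hβ T hT => ?_) fun T hT => ?_
  · obtain ⟨α, hα⟩ := exists_mem_AKD hT.1
    rw [mem_KD_iff_of_mem_AKD hα]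
    exact Relation.ReflTransGen.trans (mem_pinnedMaximalBelow.1 hβ).1
      ((mem_KD_iff_of_mem_AKD hα).1 hT.1)
  · obtain ⟨α, hα⟩ := exists_mem_AKD hT
    simp only [mem_PKD_iff_of_mem_AKD hα]
    exact ((mem_KD_iff_of_mem_AKD hα).1 hT).existsUnique_pinnedMaximalBelow

theorem pinnedPolynomial_eq_sum {m : ℕ} (β : Fin m → ℕ) :
    pinnedPolynomial β = ∑ α ∈ pinnedBelow β, demazureAtom α := by
  refine genPoly_eq_sum _ _ finite_AKD (fun α hα T hT => ?_) fun T hT => ?_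
  · exact (mem_PKD_iff_of_mem_AKD hT).2 (mem_pinnedBelow.1 hα)
  · obtain ⟨α, hα⟩ := exists_mem_AKD hT.1
    exact ⟨α, ⟨mem_pinnedBelow.2 ((mem_PKD_iff_of_mem_AKD hα).1 hT), hα⟩,
      fun α' h => eq_of_mem_AKD h.2 hα⟩

/-! ### Unitriangularity -/

theorem KohnertMove.sum_fst_lt {T T' : Diagram} (h : KohnertMove T T') :
    ∑ x ∈ T', x.1 < ∑ x ∈ T, x.1 := by
  obtain ⟨r, c, r', hr, -, hr', hvac, -, rfl⟩ := h
  rw [Finset.sum_insert (fun h => hvac (Finset.mem_of_mem_erase h)), ← Finset.add_sum_erase T _ hr]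
  omega

/-- `compDiagram β` has the greatest sum of rows among the Kohnert diagrams of `β`. -/
theorem sum_fst_lt_of_mem_KD {m : ℕ} {T : Diagram} {β : Fin m → ℕ} (hT : T ∈ KD β)
    (hne : T ≠ compDiagram β) : ∑ x ∈ T, x.1 < ∑ x ∈ compDiagram β, x.1 := by
  have key : T = compDiagram β ∨ ∑ x ∈ T, x.1 < ∑ x ∈ compDiagram β, x.1 := by
    have hT' : Relation.ReflTransGen KohnertMove (compDiagram β) T := hT
    clear hT hne
    induction hT' with
    | refl => exact Or.inl rfl
    | tail _ h2 ih =>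
      right
      rcases ih with rfl | ih
      · exact h2.sum_fst_lt
      · exact h2.sum_fst_lt.trans ih
  exact key.resolve_left hne

/-- The exponent of the monomial of a diagram. -/
noncomputable def exponent (m : ℕ) (T : Diagram) : Fin m →₀ ℕ :=
  Finsupp.equivFunOnFinite.symm fun r => wt T r

theorem prod_X_pow_wt (m : ℕ) (T : Diagram) :
    ∏ r : Fin m, (MvPolynomial.X r : MvPolynomial (Fin m) ℤ) ^ wt T r =
      MvPolynomial.monomial (exponent m T) 1 := by
  rw [MvPolynomial.monomial_eq, Finsupp.prod_fintype _ _ (by simp)]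
  simp [exponent]

theorem height_exponent {m : ℕ} {T : Diagram} (h : ∀ x ∈ T, x.1 < m) :
    height (exponent m T) = ∑ x ∈ T, x.1 := by
  have h1 : height (exponent m T) = ∑ k ∈ Finset.range m, k * wt T k :=
    Fin.sum_univ_eq_sum_range (fun k => k * wt T k) m
  rw [h1, ← Finset.sum_fiberwise_of_maps_to (t := Finset.range m) (g := Prod.fst)
    fun x hx => Finset.mem_range.2 (h x hx)]
  refine Finset.sum_congr rfl fun k _ => ?_
  rw [Finset.sum_congr rfl fun x hx => (Finset.mem_filter.1 hx).2, Finset.sum_const, wt,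
    smul_eq_mul, mul_comm]

theorem wt_compDiagram {m : ℕ} (β : Fin m → ℕ) (r : ℕ) : wt (compDiagram β) r = parts β r := by
  have e : (compDiagram β).filter (fun x => x.1 = r) =
      (Finset.range (parts β r)).image fun c => (r, c) := by
    ext ⟨s, c⟩
    rw [Finset.mem_filter, mem_compDiagram, Finset.mem_image]
    constructor
    · rintro ⟨h1, rfl⟩
      exact ⟨c, Finset.mem_range.2 h1, rfl⟩
    · rintro ⟨d, h1, h2⟩
      rw [Prod.mk.injEq] at h2
      obtain ⟨rfl, rfl⟩ := h2
      exact ⟨Finset.mem_range.1 h1, rfl⟩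
  rw [wt, e, Finset.card_image_of_injective _ fun a b h => (Prod.mk.inj h).2, Finset.card_range]

theorem fst_lt_of_mem_KD {m : ℕ} {T : Diagram} {β : Fin m → ℕ} (hT : T ∈ KD β) :
    ∀ x ∈ T, x.1 < m := by
  rintro ⟨r, c⟩ hx
  obtain ⟨α, hα⟩ := exists_mem_AKD hT
  obtain ⟨h1, h2⟩ := mem_AKD_iff.1 hα
  exact h1.lt_of_mem h2 hx

theorem compDiagram_mem_PKD {m : ℕ} (β : Fin m → ℕ) : compDiagram β ∈ PKD β :=
  mem_PKD_iff.2 ⟨Relation.ReflTransGen.refl, fun _ => mem_compDiagram⟩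

theorem exponent_compDiagram {m : ℕ} (β : Fin m → ℕ) :
    exponent m (compDiagram β) = Finsupp.equivFunOnFinite.symm β := by
  ext k
  simp [exponent, wt_compDiagram, parts_coe]

/-- A family that is unitriangular with respect to a basis `e`, for the order given by a rank
function `h` with values in `ℕ`, is a basis. -/
theorem exists_basis_of_unitriangular {ι M : Type*} [AddCommGroup M] (e : Module.Basis ι ℤ M)
    (h : ι → ℕ) (v : ι → M) (hv : ∀ i, v i - e i ∈ Submodule.span ℤ (e '' {j | h j < h i})) :
    ∃ b : Module.Basis ι ℤ M, ∀ i, b i = v i := by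
  classical
  have hli : LinearIndependent ℤ v := by
    rw [linearIndependent_iff]
    intro f hf
    by_contra hne
    obtain ⟨i, hi, hmax⟩ := f.support.exists_max_image h (Finsupp.support_nonempty_iff.2 hne)
    have hcoord : ∀ j, h j ≤ h i → e.repr (v j) i = if j = i then 1 else 0 := by
      intro j hj
      have h1 : e.repr (v j - e j) i = 0 := by
        have h2 := (Module.Basis.mem_span_image e).1 (hv j)
        by_contra h3
        have h4 := h2 (Finsupp.mem_support_iff.2 h3)
        simp only [Set.mem_ofPred_eq] at h4
        omega
      rw [map_sub, Finsupp.sub_apply, sub_eq_zero, Module.Basis.repr_self] at h1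
      rw [h1, Finsupp.single_apply]
    have h1 : e.repr (Finsupp.linearCombination ℤ v f) i = f i := by
      rw [Finsupp.linearCombination_apply, Finsupp.sum, map_sum, Finsupp.finsetSum_apply,
        Finset.sum_eq_single i]
      · rw [map_smul, Finsupp.smul_apply, hcoord i le_rfl, if_pos rfl, smul_eq_mul, mul_one]
      · intro j hj hji
        rw [map_smul, Finsupp.smul_apply, hcoord j (hmax j hj), if_neg hji, smul_zero]
      · intro hi'
        exact absurd hi hi'
    rw [hf, map_zero, Finsupp.zero_apply] at h1
    exact Finsupp.mem_support_iff.1 hi h1.symm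
  have hspan : ⊤ ≤ Submodule.span ℤ (Set.range v) := by
    have key : ∀ n i, h i = n → e i ∈ Submodule.span ℤ (Set.range v) := by
      intro n
      induction n using Nat.strong_induction_on with
      | _ n ih =>
        intro i hi
        have h1 : Submodule.span ℤ (e '' {j | h j < h i}) ≤ Submodule.span ℤ (Set.range v) := by
          rw [Submodule.span_le]
          rintro _ ⟨j, hj, rfl⟩
          exact ih (h j) (hi ▸ hj) j rfl
        have h2 := Submodule.sub_mem _ (Submodule.subset_span (Set.mem_range_self i)) (h1 (hv i))
        rwa [sub_sub_cancel] at h2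
    rw [← e.span_eq, Submodule.span_le]
    rintro _ ⟨i, rfl⟩
    exact key _ i rfl
  exact ⟨Module.Basis.mk hli hspan, fun i => Module.Basis.mk_apply hli hspan i⟩

theorem exists_basis_pinnedPolynomial (m : ℕ) :
    ∃ b : Module.Basis (Fin m → ℕ) ℤ (MvPolynomial (Fin m) ℤ), ∀ β, b β = pinnedPolynomial β := by
  refine exists_basis_of_unitriangular
    ((MvPolynomial.basisMonomials (Fin m) ℤ).reindex Finsupp.equivFunOnFinite) height
    pinnedPolynomial fun β => ?_
  have hcomp := compDiagram_mem_PKD β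
  have hlead : ((MvPolynomial.basisMonomials (Fin m) ℤ).reindex Finsupp.equivFunOnFinite) β =
      MvPolynomial.monomial (exponent m (compDiagram β)) 1 := by
    rw [Module.Basis.reindex_apply, MvPolynomial.coe_basisMonomials, exponent_compDiagram]
  rw [hlead, pinnedPolynomial, genPoly, ← Finset.add_sum_erase _ _
    ((finite_PKD β).mem_toFinset.2 hcomp), prod_X_pow_wt, add_sub_cancel_left]
  refine Submodule.sum_mem _ fun T hT => ?_
  rw [Finset.mem_erase, Set.Finite.mem_toFinset] at hT
  refine Submodule.subset_span ⟨exponent m T, ?_, ?_⟩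
  · have h1 := sum_fst_lt_of_mem_KD hT.2.1 hT.1
    have h2 : height β = height (exponent m (compDiagram β)) := by rw [exponent_compDiagram]; rfl
    rw [Set.mem_ofPred_eq, h2, height_exponent (fst_lt_of_mem_KD hcomp.1),
      height_exponent (fst_lt_of_mem_KD hT.2.1)]
    exact h1
  · rw [Module.Basis.reindex_apply, MvPolynomial.coe_basisMonomials, prod_X_pow_wt]
    congr 1

end Kohnert

theorem proposition2p9 (m : ℕ) :
    (∃ b : Module.Basis (Fin m → ℕ) ℤ (MvPolynomial (Fin m) ℤ),
      ∀ β, b β = Kohnert.pinnedPolynomial β) ∧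
    (∀ γ : Fin m → ℕ, Kohnert.demazureCharacter γ =
      ∑ β ∈ Kohnert.pinnedMaximalBelow γ, Kohnert.pinnedPolynomial β) ∧
    (∀ β : Fin m → ℕ, Kohnert.pinnedPolynomial β =
      ∑ α ∈ Kohnert.pinnedBelow β, Kohnert.demazureAtom α) :=
  ⟨Kohnert.exists_basis_pinnedPolynomial m, Kohnert.demazureCharacter_eq_sum,
    Kohnert.pinnedPolynomial_eq_sum⟩
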